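/- Let $(M,Q),(M_1,Q_1),(M_2,Q_2),\ldots$ be i.i.d. $\mathbb{R}^2$-valued random vectors, $\Pi_0=1$, $\Pi_n=M_1\cdots M_n$ and $Z_n=\sum_{k=1}^n \Pi_{k-1}Q_k$. Let $Z_\infty=\sum_{k\ge1}\Pi_{k-1}Q_k$ denote the real-valued almost sure limit of $(Z_n)$ whenever it exists; the assertion "$\mathbb{E}e^{s|Z_\infty|}<\infty$" includes that it exists. For $r>0$ put $$a_\pm(r)=\mathbb{E}\,e^{\pm rQ}\mathbf 1_{\{M=1\}},\qquad b_\pm(r)=\mathbb{E}\,e^{\pm rQ}\mathbf 1_{\{M=-1\}}\qquad(\text{values in }[0,\infty]),$$ and say that $C(r)$ holds if $$a_-(r)<1,\quad a_+(r)<1\quad\text{and}\quad b_-(r)\,b_+(r)<(1-a_-(r))(1-a_+(r)).$$ Suppose that $\mathbb{P}\{M=0\}=0$, $\mathbb{P}\{Q=0\}<1$, $\mathbb{P}\{Q+Mc=c\}<1$ for all $c\in\mathbb{R}$, and $\mathbb{P}\{|M|=1\}\in(0,1)$. (i) For every $s>0$, $\mathbb{E}e^{s|Z_\infty|}<\infty$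 holds if and only if $\mathbb{P}\{|M|\le1\}=1$, $\mathbb{E}e^{s|Q|}<\infty$ and $C(s)$ holds. (ii) For a real-valued random variable $X$ put $r(X)=\sup\{r>0:\mathbb{E}e^{r|X|}<\infty\}$, and put $r^*(M,Q)=\sup\{r>0: C(r)\text{ holds}\}$ (suprema in $[0,\infty]$, with $\sup\emptyset=0$). If $\mathbb{P}\{|M|\le1\}=1$, then $Z_\infty$ exists whenever $\min(r(Q),r^*(M,Q))>0$, and, whenever $Z_\infty$ exists, $$r(Z_\infty)=\min\big(r(Q),\,r^*(M,Q)\big).$$ -/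

import Mathlib

open MeasureTheory ProbabilityTheory Filter Topology
open scoped ENNReal

/-- `perpSum M Q n ω = ∑_{k=1}^n Π_{k-1} Q_k`, where `Π_k = M_1 ⋯ M_k`. The sequences are indexed
from `0`, so `M k`, `Q k` stand for `M_{k+1}`, `Q_{k+1}`. -/
def perpSum {Ω : Type*} (M Q : ℕ → Ω → ℝ) (n : ℕ) (ω : Ω) : ℝ :=
  ∑ k ∈ Finset.range n, (∏ j ∈ Finset.range k, M j ω) * Q k ω

/-- `Z` is (a version of) the perpetuity `Z_∞ = ∑_{k ≥ 1} Π_{k-1} Q_k`: the partial sums converge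
almost surely to the real-valued `Z`. -/
def IsPerpetuity {Ω : Type*} [MeasurableSpace Ω] (μ : Measure Ω) (M Q : ℕ → Ω → ℝ)
    (Z : Ω → ℝ) : Prop :=
  ∀ᵐ ω ∂μ, Tendsto (fun n => perpSum M Q n ω) atTop (𝓝 (Z ω))

/-- `E e^{s |X|}`, with values in `[0, ∞]`. -/
noncomputable def expAbsMoment {Ω : Type*} [MeasurableSpace Ω] (μ : Measure Ω) (X : Ω → ℝ)
    (s : ℝ) : ℝ≥0∞ :=
  ∫⁻ ω, ENNReal.ofReal (Real.exp (s * |X ω|)) ∂μ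

/-- `E e^{t Q} 1_{M = m}`, with values in `[0, ∞]`. -/
noncomputable def expMomentOn {Ω : Type*} [MeasurableSpace Ω] (μ : Measure Ω) (M Q : Ω → ℝ)
    (m t : ℝ) : ℝ≥0∞ :=
  ∫⁻ ω in {ω | M ω = m}, ENNReal.ofReal (Real.exp (t * Q ω)) ∂μ

/-- With `a_± = E e^{± s Q} 1_{M = 1}` and `b_± = E e^{± s Q} 1_{M = -1}`: the condition
`a_- < 1`, `a_+ < 1` and `b_- b_+ < (1 - a_-) (1 - a_+)`. The subtractions in `[0, ∞]` are genuine
since `a_± < 1`. -/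
def UnitModulusCond {Ω : Type*} [MeasurableSpace Ω] (μ : Measure Ω) (M Q : Ω → ℝ)
    (s : ℝ) : Prop :=
  expMomentOn μ M Q 1 (-s) < 1 ∧ expMomentOn μ M Q 1 s < 1 ∧
    expMomentOn μ M Q (-1) (-s) * expMomentOn μ M Q (-1) s <
      (1 - expMomentOn μ M Q 1 (-s)) * (1 - expMomentOn μ M Q 1 s)

/-- `r(X) = sup {r > 0 : E e^{r |X|} < ∞}` in `[0, ∞]` (with `sup ∅ = 0`). -/
noncomputable def expAbscissa {Ω : Type*} [MeasurableSpace Ω] (μ : Measure Ω)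
    (X : Ω → ℝ) : ℝ≥0∞ :=
  ⨆ (r : ℝ) (_ : 0 < r ∧ expAbsMoment μ X r < ∞), ENNReal.ofReal r

/-- `r*(M, Q)`: the supremum in `[0, ∞]` of all `r > 0` that satisfy `UnitModulusCond`. -/
noncomputable def unitModulusAbscissa {Ω : Type*} [MeasurableSpace Ω] (μ : Measure Ω)
    (M Q : Ω → ℝ) : ℝ≥0∞ :=
  ⨆ (r : ℝ) (_ : 0 < r ∧ UnitModulusCond μ M Q r), ENNReal.ofReal r

/-! Write φ(t) = E e^{tZ}. Everything comes from the equation Z = Q + M Z' in law, with Z' a copy of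
Z independent of (M, Q) (`IsPerpetuity.isFixedLaw`).

Necessity. If |M| > 1 had positive probability, repeated expansion would make the tails of Z too
heavy (`IsFixedLaw.ae_abs_le_one`). Once |M| ≤ 1, the moment of Q is dominated by that of Z.
Splitting φ(±s) according to M = 1, M = -1 and |M| ≠ 1, the last piece being strictly positive,
shows that the nonnegative matrix with rows (a_+, b_+) and (b_-, a_-) strictly decreases the
positive vector (φ(s), φ(-s)). Multiplying the two inequalities gives C(s).

Sufficiency. Conversely C(s) yields a strictly decreased positive vector (1, e^{sd}), that is, one d
for which replacing Q by Q + d 1_{M=-1} makes E e^{±sQ} 1_{|M|=1} less than 1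
(`UnitModulusCond.exists_tilt`). From d one builds h ≥ 1 with E e^{tQ} h(tM) ≤ h(t) for |t| ≤ s
(`UnitModulusCond.exists_supersolution`). Then e^{tZ_n} h(tΠ_n) is a supermartingale, and Fatou's
lemma bounds φ(±s) by h(±s).

Abscissas. The tilted moment is at most a convex combination of P(|M| = 1) < 1 and its values at ±s,
so C(s) implies C(t) for 0 < t ≤ s (`UnitModulusCond.mono`). Hence both sufficient conditions hold
at any common smaller exponent. -/

/-! ### Independence of functions of disjoint sets of coordinates -/

/-- Functions of a family of independent random variables that depend on disjoint sets of
coordinates are independent. -/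
theorem ProbabilityTheory.iIndepFun.indepFun_of_dependsOn {Ω ι β γ δ : Type*}
    [MeasurableSpace Ω] {μ : Measure Ω} [MeasurableSpace β] [MeasurableSpace γ]
    [MeasurableSpace δ] [Inhabited β] {f : ι → Ω → β} (hf : ∀ i, Measurable (f i))
    (hi : iIndepFun f μ) {S T : Set ι} (hST : Disjoint S T)
    {φ : (ι → β) → γ} {ψ : (ι → β) → δ} (hφ : Measurable φ) (hψ : Measurable ψ)
    (hφS : DependsOn φ S) (hψT : DependsOn ψ T) :
    IndepFun (fun ω => φ fun i => f i ω) (fun ω => ψ fun i => f i ω) μ := by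
  classical
  have key := indep_iSup_of_disjoint (fun i => (hf i).comap_le) hi.iIndep hST
  -- Filling the coordinates outside U with a constant makes the whole sequence measurable for the
  -- σ-algebra of U, while a function that depends only on U does not notice.
  have meas : ∀ (U : Set ι), @Measurable Ω (ι → β) (⨆ i ∈ U, MeasurableSpace.comap (f i) inferInstance) _
      (fun ω i => if i ∈ U then f i ω else default) := by
    intro U
    refine @measurable_pi_lambda _ _ _ (⨆ i ∈ U, MeasurableSpace.comap (f i) inferInstance) _ _ ?_
    intro i
    by_cases h : i ∈ U
    · simp only [h, if_true]
      refine (comap_measurable (f i)).mono ?_ le_rfl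
      exact le_iSup₂_of_le (f := fun i _ => MeasurableSpace.comap (f i) inferInstance) i h le_rfl
    · simp only [h, if_false]
      exact measurable_const
  have eS : (fun ω => φ fun i => f i ω) = fun ω => φ fun i => if i ∈ S then f i ω else default := by
    ext ω; exact hφS fun i hi => by simp [hi]
  have eT : (fun ω => ψ fun i => f i ω) = fun ω => ψ fun i => if i ∈ T then f i ω else default := by
    ext ω; exact hψT fun i hi => by simp [hi]
  rw [eS, eT, IndepFun_iff_Indep]
  refine indep_of_indep_of_le_left (indep_of_indep_of_le_right key ?_) ?_
  · exact (hψ.comp (meas T)).comap_le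
  · exact (hφ.comp (meas S)).comap_le

theorem ProbabilityTheory.IndepFun.lintegral_prodMk {Ω β γ : Type*} [MeasurableSpace Ω]
    {μ : Measure Ω} [IsFiniteMeasure μ] [MeasurableSpace β] [MeasurableSpace γ]
    {X : Ω → β} {Y : Ω → γ} (h : IndepFun X Y μ) (hX : Measurable X) (hY : Measurable Y)
    {F : β × γ → ℝ≥0∞} (hF : Measurable F) :
    ∫⁻ ω, F (X ω, Y ω) ∂μ = ∫⁻ ω, ∫⁻ y, F (X ω, y) ∂(μ.map Y) ∂μ := by
  rw [← lintegral_map (f := F) hF (hX.prodMk hY),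
    h.map_prod_eq_prod_map_map hX.aemeasurable hY.aemeasurable,
    lintegral_prod _ hF.aemeasurable, lintegral_map _ hX]
  exact hF.lintegral_prod_right'

/-! ### The perpetuity as a functional of the sequence and its fixed point equation -/

section Perpetuity

variable {Ω : Type*}

theorem perpSum_succ' (M Q : ℕ → Ω → ℝ) (n : ℕ) (ω : Ω) :
    perpSum M Q (n + 1) ω =
      Q 0 ω + M 0 ω * perpSum (fun k => M (k + 1)) (fun k => Q (k + 1)) n ω := by
  simp only [perpSum, Finset.sum_range_succ', Finset.prod_range_succ', Finset.mul_sum]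
  simp only [Finset.range_zero, Finset.prod_empty, one_mul]
  rw [add_comm]
  congr 1
  exact Finset.sum_congr rfl fun k _ => by ring

theorem measurable_perpSum [MeasurableSpace Ω] {M Q : ℕ → Ω → ℝ} (hM : ∀ n, Measurable (M n)) (hQ : ∀ n, Measurable (Q n)) (n : ℕ) :
    Measurable (perpSum M Q n) := by
  unfold perpSum
  fun_prop

/-- The limit functional of a perpetuity on the sequence space. -/
noncomputable def perpLimit (x : ℕ → ℝ × ℝ) : ℝ :=
  limsup (fun n => perpSum (fun k (x : ℕ → ℝ × ℝ) => (x k).1) (fun k x => (x k).2) n x) atTop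

theorem measurable_perpLimit : Measurable perpLimit :=
  Measurable.limsup fun n => measurable_perpSum (fun k => by fun_prop) (fun k => by fun_prop) n

theorem perpLimit_eq {M Q : ℕ → Ω → ℝ} {ω : Ω} {z : ℝ}
    (h : Tendsto (fun n => perpSum M Q n ω) atTop (𝓝 z)) :
    perpLimit (fun k => (M k ω, Q k ω)) = z :=
  Tendsto.limsup_eq h

variable [MeasurableSpace Ω] {μ : Measure Ω} {M Q : ℕ → Ω → ℝ}

theorem IsPerpetuity.ae_eq_perpLimit {Z : Ω → ℝ} (h : IsPerpetuity μ M Q Z) :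
    Z =ᵐ[μ] fun ω => perpLimit fun k => (M k ω, Q k ω) := by
  filter_upwards [h] with ω hω using (perpLimit_eq hω).symm

/-- `ζ` solves the distributional fixed point equation `Z = Q + M Z'` in law, where `Z' ∼ Z ∼ ζ` is
independent of `(M, Q)`. -/
def IsFixedLaw (μ : Measure Ω) (M Q : Ω → ℝ) (ζ : Measure ℝ) : Prop :=
  ∀ f : ℝ → ℝ≥0∞, Measurable f →
    ∫⁻ z, f z ∂ζ = ∫⁻ ω, ∫⁻ z, f (Q ω + M ω * z) ∂ζ ∂μ

theorem map_shift_eq_of_iid [IsProbabilityMeasure μ] {β : Type*} [MeasurableSpace β]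
    {X : ℕ → Ω → β} (hX : ∀ n, Measurable (X n)) (hi : iIndepFun X μ)
    (hid : ∀ n, IdentDistrib (X n) (X 0) μ μ) :
    μ.map (fun ω n => X (n + 1) ω) = μ.map (fun ω n => X n ω) := by
  have hs : iIndepFun (fun n => X (n + 1)) μ := hi.precomp (add_left_injective 1)
  rw [hi.map_fun_eq_infinitePi_map hX, hs.map_fun_eq_infinitePi_map fun n => hX (n + 1)]
  congr 1
  ext1 n
  rw [(hid n).map_eq, (hid (n + 1)).map_eq]

/-- Z' is the perpetuity of the shifted sequence: it has the law of Z and is independent of the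
first pair. It converges because M ≠ 0 allows solving Z_{n+1} = Q + M Z'_n for Z'_n. Working with
`perpLimit` makes measurability and dependence on the tail explicit. -/
theorem IsPerpetuity.isFixedLaw [IsProbabilityMeasure μ] {Z : Ω → ℝ}
    (hZ : IsPerpetuity μ M Q Z) (hM : ∀ n, Measurable (M n)) (hQ : ∀ n, Measurable (Q n))
    (hindep : iIndepFun (fun n ω => (M n ω, Q n ω)) μ)
    (hident : ∀ n, IdentDistrib (fun ω => (M n ω, Q n ω)) (fun ω => (M 0 ω, Q 0 ω)) μ μ)
    (hM0 : ∀ᵐ ω ∂μ, M 0 ω ≠ 0) :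
    IsFixedLaw μ (M 0) (Q 0) (μ.map Z) := by
  have hMQ : ∀ n, Measurable fun ω => (M n ω, Q n ω) := fun n => (hM n).prodMk (hQ n)
  set L : Ω → ℝ := fun ω => perpLimit fun k => (M k ω, Q k ω) with hL
  set L' : Ω → ℝ := fun ω => perpLimit fun k => (M (k + 1) ω, Q (k + 1) ω) with hL'
  have mL : Measurable L := measurable_perpLimit.comp (measurable_pi_lambda _ hMQ)
  have mL' : Measurable L' :=
    measurable_perpLimit.comp (measurable_pi_lambda _ fun n => hMQ (n + 1))
  have hlaw : μ.map L' = μ.map L := by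
    have := congrArg (Measure.map perpLimit) (map_shift_eq_of_iid hMQ hindep hident)
    rwa [Measure.map_map measurable_perpLimit (measurable_pi_lambda _ fun n => hMQ (n + 1)),
      Measure.map_map measurable_perpLimit (measurable_pi_lambda _ hMQ)] at this
  have hrec : ∀ᵐ ω ∂μ, L ω = Q 0 ω + M 0 ω * L' ω := by
    filter_upwards [hZ, hM0] with ω h1 h2
    have h3 : Tendsto (fun n => perpSum (fun k => M (k + 1)) (fun k => Q (k + 1)) n ω) atTop
        (𝓝 ((Z ω - Q 0 ω) / M 0 ω)) := by
      have h4 := (((tendsto_add_atTop_iff_nat 1).2 h1).sub_const (Q 0 ω)).div_const (M 0 ω)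
      refine h4.congr fun n => ?_
      rw [perpSum_succ']
      field_simp
      ring
    have e1 : L ω = Z ω := perpLimit_eq h1
    have e2 : L' ω = (Z ω - Q 0 ω) / M 0 ω := perpLimit_eq h3
    rw [e1, e2]
    field_simp
    ring
  have hind : IndepFun (fun ω => (M 0 ω, Q 0 ω)) L' μ := by
    refine hindep.indepFun_of_dependsOn hMQ (S := {0}) (T := {n | n ≠ 0}) (by simp)
      (φ := fun x => x 0) (ψ := fun x => perpLimit fun k => x (k + 1)) (measurable_pi_apply 0)
      (measurable_perpLimit.comp (measurable_pi_lambda _ fun k => measurable_pi_apply (k + 1)))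
      ?_ ?_
    · intro x y h
      exact h 0 rfl
    · intro x y h
      exact congrArg perpLimit (funext fun k => h (k + 1) (Nat.succ_ne_zero k))
  intro f hf
  rw [Measure.map_congr hZ.ae_eq_perpLimit, lintegral_map hf mL]
  calc ∫⁻ ω, f (L ω) ∂μ = ∫⁻ ω, f (Q 0 ω + M 0 ω * L' ω) ∂μ :=
        lintegral_congr_ae (by filter_upwards [hrec] with ω h; rw [h])
    _ = _ := by
        rw [hind.lintegral_prodMk (F := fun p => f (p.1.2 + p.1.1 * p.2)) (hMQ 0) mL'
          (by fun_prop), hlaw]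

end Perpetuity

/-! ### Necessity: consequences of the fixed point equation -/

theorem tendsto_exp_mul_pow_mul_pow_atTop {a r p : ℝ} (ha : 0 < a) (hr : 1 < r) (hp : 0 < p) :
    Tendsto (fun n : ℕ => Real.exp (a * r ^ n) * p ^ n) atTop atTop := by
  have h1 : Tendsto (fun n : ℕ => r ^ n / (n : ℝ)) atTop atTop := by
    have h := tendsto_pow_const_div_const_pow_of_one_lt 1 hr
    have h' : Tendsto (fun n : ℕ => (n : ℝ) ^ 1 / r ^ n) atTop (𝓝[>] 0) := by
      refine tendsto_nhdsWithin_iff.2 ⟨h, ?_⟩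
      filter_upwards [eventually_gt_atTop 0] with n hn
      have : (0 : ℝ) < n := by exact_mod_cast hn
      show (0 : ℝ) < (n : ℝ) ^ 1 / r ^ n
      positivity
    refine h'.inv_tendsto_nhdsGT_zero.congr fun n => ?_
    simp
  have h2 : Tendsto (fun n : ℕ => (n : ℝ) * (a * (r ^ n / n) + Real.log p)) atTop atTop :=
    tendsto_natCast_atTop_atTop.atTop_mul_atTop₀
      (tendsto_atTop_add_const_right _ _ (h1.const_mul_atTop ha))
  refine (Real.tendsto_exp_atTop.comp h2).congr' ?_
  filter_upwards [eventually_gt_atTop 0] with n hn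
  have hn' : (n : ℝ) ≠ 0 := by exact_mod_cast hn.ne'
  have e : (n : ℝ) * (a * (r ^ n / n) + Real.log p) = a * r ^ n + n * Real.log p := by
    field_simp
  simp only [Function.comp]
  rw [e, Real.exp_add, Real.exp_nat_mul, Real.exp_log hp]

section FixedLaw

variable {Ω : Type*} [MeasurableSpace Ω] {μ : Measure Ω} {M Q : Ω → ℝ} {ζ : Measure ℝ}

/-- If `|M| > 1` with positive probability, a non-degenerate solution of the fixed point equation
has no exponential moments. -/
theorem IsFixedLaw.ae_abs_le_one [IsProbabilityMeasure μ] [IsProbabilityMeasure ζ]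
    (hfix : IsFixedLaw μ M Q ζ) (hM : Measurable M) (hQ : Measurable Q)
    (hnd : ∀ c : ℝ, ζ {z | z ≠ c} ≠ 0) {s : ℝ} (hs : 0 < s)
    (hmom : ∫⁻ z, ENNReal.ofReal (Real.exp (s * |z|)) ∂ζ < ∞) :
    ∀ᵐ ω ∂μ, |M ω| ≤ 1 := by
  by_contra hcon
  have hMQ : Measurable fun ω => (M ω, Q ω) := hM.prodMk hQ
  have hpos : (μ.map fun ω => (M ω, Q ω)) {p | 1 < |p.1|} ≠ 0 := by
    rw [Measure.map_apply hMQ (measurableSet_lt measurable_const (by fun_prop))]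
    intro h
    apply hcon
    rw [ae_iff]
    simpa [not_le] using h
  -- A point of the support of (M, Q) with |m₀| > 1; z₀ below is the fixed point of z ↦ q₀ + m₀ z.
  obtain ⟨⟨m₀, q₀⟩, hm₀, hnhds⟩ := exists_mem_forall_mem_nhdsWithin_pos_measure hpos
  simp only [Set.mem_ofPred_eq] at hm₀
  have hm1 : 1 - m₀ ≠ 0 := by
    intro h
    have : m₀ = 1 := by linarith
    simp [this] at hm₀
  set z₀ : ℝ := q₀ / (1 - m₀) with hz₀
  obtain ⟨x₀, hx₀, hw⟩ : ∃ x₀ : ℝ, 0 < x₀ ∧ ζ {z | x₀ < |z - z₀|} ≠ 0 := by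
    by_contra! h
    apply hnd z₀
    have : {z | z ≠ z₀} ⊆ ⋃ n : ℕ, {z | 1 / ((n : ℝ) + 1) < |z - z₀|} := by
      intro z hz
      obtain ⟨n, hn⟩ := exists_nat_one_div_lt (abs_pos.2 (sub_ne_zero.2 hz))
      exact Set.mem_iUnion.2 ⟨n, hn⟩
    exact measure_mono_null this (measure_iUnion_null fun n => h _ (by positivity))
  set c : ℝ := (1 + |m₀|) / 2 with hc
  have hc1 : 1 < c := by rw [hc]; linarith
  have hcm : c < |m₀| := by rw [hc]; linarith
  set r : ℝ := (1 + c) / 2 with hr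
  have hr1 : 1 < r := by rw [hr]; linarith
  -- For pairs in U, the map expands distances by c and moves z₀ by less than (c - 1) x₀ / 2.
  -- Distances from z₀ beyond x₀ therefore grow at least by c - (c - 1)/2 = r.
  set U : Set (ℝ × ℝ) := {p | c < |p.1| ∧ |p.2 + p.1 * z₀ - z₀| < (c - 1) * x₀ / 2} with hU
  have hUo : IsOpen U := by
    have h1 : IsOpen {p : ℝ × ℝ | c < |p.1|} := isOpen_lt continuous_const (by fun_prop)
    have h2 : IsOpen {p : ℝ × ℝ | |p.2 + p.1 * z₀ - z₀| < (c - 1) * x₀ / 2} :=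
      isOpen_lt (by fun_prop) continuous_const
    exact h1.inter h2
  have hUmem : (m₀, q₀) ∈ U := by
    refine ⟨hcm, ?_⟩
    have : q₀ + m₀ * z₀ - z₀ = 0 := by rw [hz₀]; field_simp; ring
    simp only [this, abs_zero]
    have : 0 < c - 1 := by linarith
    positivity
  set p : ℝ≥0∞ := μ {ω | (M ω, Q ω) ∈ U} with hp
  have hp0 : p ≠ 0 := by
    have := hnhds U (mem_nhdsWithin_of_mem_nhds (hUo.mem_nhds hUmem))
    rw [Measure.map_apply hMQ hUo.measurableSet] at this
    exact this.ne'
  have mtail : ∀ x : ℝ, MeasurableSet {z : ℝ | x < |z - z₀|} := fun x =>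
    measurableSet_lt measurable_const (by fun_prop)
  have step : ∀ x, x₀ ≤ x → p * ζ {z | x < |z - z₀|} ≤ ζ {z | r * x < |z - z₀|} := by
    intro x hx
    have h := hfix ({z | r * x < |z - z₀|}.indicator 1) (measurable_one.indicator (mtail _))
    rw [lintegral_indicator_one (mtail _)] at h
    rw [h]
    have hmU : MeasurableSet {ω | (M ω, Q ω) ∈ U} := hMQ hUo.measurableSet
    calc p * ζ {z | x < |z - z₀|}
        = ∫⁻ ω, {ω | (M ω, Q ω) ∈ U}.indicator (fun _ => ζ {z | x < |z - z₀|}) ω ∂μ := by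
          rw [lintegral_indicator_const hmU, mul_comm]
      _ ≤ _ := by
          refine lintegral_mono fun ω => ?_
          by_cases hω : ω ∈ {ω | (M ω, Q ω) ∈ U}
          · rw [Set.indicator_of_mem hω, ← lintegral_indicator_one (mtail _)]
            refine lintegral_mono fun z => ?_
            by_cases hz : z ∈ {z : ℝ | x < |z - z₀|}
            · have hz' : Q ω + M ω * z ∈ {z | r * x < |z - z₀|} := by
                obtain ⟨h1, h2⟩ := hω
                have hz : x < |z - z₀| := hz
                have h3 : |M ω * (z - z₀)| ≤
                    |Q ω + M ω * z - z₀| + |Q ω + M ω * z₀ - z₀| := by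
                  have := abs_sub (Q ω + M ω * z - z₀) (Q ω + M ω * z₀ - z₀)
                  rwa [show Q ω + M ω * z - z₀ - (Q ω + M ω * z₀ - z₀) = M ω * (z - z₀) by ring]
                    at this
                rw [abs_mul] at h3
                have h4 : c * |z - z₀| ≤ |M ω| * |z - z₀| := by gcongr
                have h5 : |Q ω + M ω * z₀ - z₀| < (c - 1) * x₀ / 2 := h2
                have h6 : (c - 1) * x₀ ≤ (c - 1) * |z - z₀| :=
                  mul_le_mul_of_nonneg_left (hx.trans hz.le) (by linarith)
                have h7 : r * x < r * |z - z₀| := mul_lt_mul_of_pos_left hz (by linarith)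
                have h8 : r * |z - z₀| = c * |z - z₀| - (c - 1) * |z - z₀| / 2 := by
                  rw [hr]; ring
                show r * x < |Q ω + M ω * z - z₀|
                linarith
              rw [Set.indicator_of_mem hz, Set.indicator_of_mem hz']
              exact le_rfl
            · rw [Set.indicator_of_notMem hz]; exact zero_le
          · rw [Set.indicator_of_notMem hω]; exact zero_le
  have iter : ∀ n : ℕ, p ^ n * ζ {z | x₀ < |z - z₀|} ≤ ζ {z | r ^ n * x₀ < |z - z₀|} := by
    intro n
    induction n with
    | zero => simp
    | succ n ih =>
      calc p ^ (n + 1) * ζ {z | x₀ < |z - z₀|}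
          = p * (p ^ n * ζ {z | x₀ < |z - z₀|}) := by ring
        _ ≤ p * ζ {z | r ^ n * x₀ < |z - z₀|} := by gcongr
        _ ≤ ζ {z | r * (r ^ n * x₀) < |z - z₀|} :=
            step _ (le_mul_of_one_le_left hx₀.le (one_le_pow₀ hr1.le))
        _ = _ := by rw [← mul_assoc, ← pow_succ']
  have markov : ∀ n : ℕ, ENNReal.ofReal (Real.exp (s * (r ^ n * x₀ - |z₀|))) *
      (p ^ n * ζ {z | x₀ < |z - z₀|}) ≤ ∫⁻ z, ENNReal.ofReal (Real.exp (s * |z|)) ∂ζ := by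
    intro n
    refine (mul_le_mul_right (iter n) _).trans ?_
    refine le_trans ?_ (mul_meas_ge_le_lintegral (by fun_prop)
      (ENNReal.ofReal (Real.exp (s * (r ^ n * x₀ - |z₀|)))))
    refine mul_le_mul_right (measure_mono fun z hz => ?_) _
    refine ENNReal.ofReal_le_ofReal (Real.exp_le_exp.2 (mul_le_mul_of_nonneg_left ?_ hs.le))
    have hz : r ^ n * x₀ < |z - z₀| := hz
    have := abs_sub z z₀
    linarith
  have hpf : p ≠ ∞ := measure_ne_top _ _
  have hwf : ζ {z | x₀ < |z - z₀|} ≠ ∞ := measure_ne_top _ _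
  set K := (∫⁻ z, ENNReal.ofReal (Real.exp (s * |z|)) ∂ζ).toReal with hK
  have real_markov : ∀ n : ℕ, Real.exp (s * x₀ * r ^ n) * p.toReal ^ n *
      ((ζ {z | x₀ < |z - z₀|}).toReal * Real.exp (-(s * |z₀|))) ≤ K := by
    intro n
    have h := ENNReal.toReal_mono hmom.ne (markov n)
    rw [ENNReal.toReal_mul, ENNReal.toReal_ofReal (Real.exp_pos _).le, ENNReal.toReal_mul,
      ENNReal.toReal_pow] at h
    refine le_of_eq_of_le ?_ h
    rw [show s * (r ^ n * x₀ - |z₀|) = s * x₀ * r ^ n + -(s * |z₀|) by ring, Real.exp_add]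
    ring
  -- The tail beyond r^n x₀ is at least of order p^n, whereas Markov's inequality forces decay like
  -- e^{-s x₀ r^n}.
  have lim := (tendsto_exp_mul_pow_mul_pow_atTop (mul_pos hs hx₀) hr1
    (ENNReal.toReal_pos hp0 hpf)).atTop_mul_const
    (mul_pos (ENNReal.toReal_pos hw hwf) (Real.exp_pos (-(s * |z₀|))))
  obtain ⟨n, hn⟩ := (lim.eventually_gt_atTop K).exists
  exact absurd (real_markov n) (not_le.2 hn)

/-- Since |M| ≤ 1, e^{t(Q + Mz)} ≥ e^{tQ} e^{-s|z|} for |t| = s; integrating, E e^{tZ} ≥ κ E e^{tQ}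
with κ = E e^{-s|Z|} > 0. -/
theorem IsFixedLaw.expAbsMoment_lt_top [IsProbabilityMeasure ζ]
    (hfix : IsFixedLaw μ M Q ζ) (hM : ∀ᵐ ω ∂μ, |M ω| ≤ 1) (hQ : Measurable Q)
    {s : ℝ} (hs : 0 < s) (hmom : ∫⁻ z, ENNReal.ofReal (Real.exp (s * |z|)) ∂ζ < ∞) :
    expAbsMoment μ Q s < ∞ := by
  set κ := ∫⁻ z, ENNReal.ofReal (Real.exp (-(s * |z|))) ∂ζ with hκ
  have hκ0 : κ ≠ 0 := by
    intro h
    rw [hκ, lintegral_eq_zero_iff (by fun_prop)] at h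
    obtain ⟨z, hz⟩ := h.exists
    simp only [Pi.zero_apply, ENNReal.ofReal_eq_zero] at hz
    exact absurd hz (not_le.2 (Real.exp_pos _))
  have hκf : κ ≠ ∞ := by
    refine ((lintegral_mono fun z => ENNReal.ofReal_le_ofReal
      (Real.exp_le_exp.2 ?_)).trans_lt hmom).ne
    have : 0 ≤ s * |z| := by positivity
    linarith
  have main : ∀ t : ℝ, |t| = s → ∫⁻ ω, ENNReal.ofReal (Real.exp (t * Q ω)) ∂μ < ∞ := by
    intro t ht
    have h1 : ∫⁻ z, ENNReal.ofReal (Real.exp (t * z)) ∂ζ < ∞ := by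
      refine (lintegral_mono fun z => ENNReal.ofReal_le_ofReal
        (Real.exp_le_exp.2 ?_)).trans_lt hmom
      rw [← ht, ← abs_mul]; exact le_abs_self _
    rw [hfix (fun z => ENNReal.ofReal (Real.exp (t * z))) (by fun_prop)] at h1
    have h2 : (∫⁻ ω, ENNReal.ofReal (Real.exp (t * Q ω)) ∂μ) * κ < ∞ := by
      rw [← lintegral_mul_const _ (by fun_prop)]
      refine lt_of_le_of_lt (lintegral_mono_ae ?_) h1
      filter_upwards [hM] with ω hω
      rw [hκ, ← lintegral_const_mul _ (by fun_prop)]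
      refine lintegral_mono fun z => ?_
      rw [← ENNReal.ofReal_mul (Real.exp_pos _).le, ← Real.exp_add]
      refine ENNReal.ofReal_le_ofReal (Real.exp_le_exp.2 ?_)
      have h3 : -(s * |z|) ≤ t * (M ω * z) := by
        have h4 : |t * (M ω * z)| ≤ s * |z| := by
          rw [abs_mul, abs_mul, ht]
          have := mul_le_mul_of_nonneg_right hω (abs_nonneg z)
          rw [one_mul] at this
          gcongr
        exact (abs_le.1 h4).1
      linarith
    exact ENNReal.lt_top_of_mul_ne_top_left h2.ne hκ0
  refine lt_of_le_of_lt (?_ : _ ≤ (∫⁻ ω, ENNReal.ofReal (Real.exp (s * Q ω)) ∂μ) +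
    ∫⁻ ω, ENNReal.ofReal (Real.exp (-s * Q ω)) ∂μ) (ENNReal.add_lt_top.2
      ⟨main s (abs_of_pos hs), main (-s) (by rw [abs_neg, abs_of_pos hs])⟩)
  rw [← lintegral_add_left (by fun_prop)]
  refine lintegral_mono fun ω => ?_
  rcases abs_cases (Q ω) with h | h
  · simp only [h.1]; exact le_self_add
  · simp only [h.1, mul_neg, neg_mul]; exact le_add_self

/-- Rearranged, the hypotheses read b y < (1 - a) x and b' x < (1 - a') y; multiply them and cancel
x y. -/
theorem ENNReal.mul_lt_mul_one_sub_of_add_lt {a b a' b' x y : ℝ≥0∞} (hx : x ≠ ∞)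
    (hy : y ≠ ∞) (h : a * x + b * y < x) (h' : a' * y + b' * x < y) :
    a' < 1 ∧ a < 1 ∧ b' * b < (1 - a') * (1 - a) := by
  have hx0 : x ≠ 0 := (zero_le.trans_lt h).ne'
  have hy0 : y ≠ 0 := (zero_le.trans_lt h').ne'
  have ha : a < 1 := by
    by_contra! hc
    exact absurd (h.trans_le (le_mul_of_one_le_left zero_le hc)) (not_lt.2 le_self_add)
  have ha' : a' < 1 := by
    by_contra! hc
    exact absurd (h'.trans_le (le_mul_of_one_le_left zero_le hc)) (not_lt.2 le_self_add)
  refine ⟨ha', ha, ?_⟩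
  have hax : a * x ≠ ∞ := ENNReal.mul_ne_top ha.ne_top hx
  have hay : a' * y ≠ ∞ := ENNReal.mul_ne_top ha'.ne_top hy
  have h1 : b * y < (1 - a) * x := by
    rw [ENNReal.sub_mul (fun _ _ => hx), one_mul]
    exact lt_tsub_iff_left.2 h
  have h2 : b' * x < (1 - a') * y := by
    rw [ENNReal.sub_mul (fun _ _ => hy), one_mul]
    exact lt_tsub_iff_left.2 h'
  have h3 := ENNReal.mul_lt_mul h2 h1
  have e1 : b' * x * (b * y) = b' * b * (x * y) := by ring
  have e2 : (1 - a') * y * ((1 - a) * x) = (1 - a') * (1 - a) * (x * y) := by ring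
  rw [e1, e2] at h3
  exact lt_of_mul_lt_mul_right' h3

/-- The left side is the contribution of |M| = 1 to φ(t) = E e^{tQ} φ(tM). The rest is positive
because φ > 0 everywhere, and strictness survives since φ(t) is finite. -/
theorem IsFixedLaw.expMomentOn_add_lt [IsFiniteMeasure μ] [IsProbabilityMeasure ζ]
    (hfix : IsFixedLaw μ M Q ζ) (hM : Measurable M) (hQ : Measurable Q)
    (hM1 : μ {ω | |M ω| ≠ 1} ≠ 0) {t : ℝ}
    (hmom : ∫⁻ z, ENNReal.ofReal (Real.exp (t * z)) ∂ζ < ∞) :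
    expMomentOn μ M Q 1 t * (∫⁻ z, ENNReal.ofReal (Real.exp (t * z)) ∂ζ) +
      expMomentOn μ M Q (-1) t * (∫⁻ z, ENNReal.ofReal (Real.exp (-t * z)) ∂ζ) <
      ∫⁻ z, ENNReal.ofReal (Real.exp (t * z)) ∂ζ := by
  set φ : ℝ → ℝ≥0∞ := fun u => ∫⁻ z, ENNReal.ofReal (Real.exp (u * z)) ∂ζ with hφ
  have hφ0 : ∀ u, φ u ≠ 0 := by
    intro u h
    simp only [hφ] at h
    rw [lintegral_eq_zero_iff (by fun_prop)] at h
    obtain ⟨z, hz⟩ := h.exists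
    simp only [Pi.zero_apply, ENNReal.ofReal_eq_zero] at hz
    exact absurd hz (not_le.2 (Real.exp_pos _))
  have hφm : Measurable φ := by
    have : Measurable fun p : ℝ × ℝ => ENNReal.ofReal (Real.exp (p.1 * p.2)) := by fun_prop
    exact this.lintegral_prod_right'
  set F : Ω → ℝ≥0∞ := fun ω => ENNReal.ofReal (Real.exp (t * Q ω)) * φ (t * M ω) with hF
  have hFm : Measurable F := by fun_prop
  have hφF : φ t = ∫⁻ ω, F ω ∂μ := by
    simp only [hφ]
    rw [hfix (fun z => ENNReal.ofReal (Real.exp (t * z))) (by fun_prop)]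
    refine lintegral_congr fun ω => ?_
    simp only [hF, hφ]
    rw [← lintegral_const_mul _ (by fun_prop)]
    refine lintegral_congr fun z => ?_
    rw [← ENNReal.ofReal_mul (Real.exp_pos _).le, ← Real.exp_add]
    ring_nf
  have mset : ∀ m : ℝ, MeasurableSet {ω | M ω = m} := fun m => hM (measurableSet_singleton m)
  have hset : ∀ m : ℝ, ∫⁻ ω in {ω | M ω = m}, F ω ∂μ = expMomentOn μ M Q m t * φ (t * m) := by
    intro m
    rw [expMomentOn, ← lintegral_mul_const _ (by fun_prop)]
    refine setLIntegral_congr_fun (mset m) fun ω hω => ?_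
    have hω : M ω = m := hω
    simp only [hF, hω]
  have hC : MeasurableSet {ω | |M ω| ≠ 1} :=
    (measurableSet_eq_fun (by fun_prop) measurable_const).compl
  have hCpos : ∫⁻ ω in {ω | |M ω| ≠ 1}, F ω ∂μ ≠ 0 := by
    intro h
    rw [lintegral_eq_zero_iff hFm] at h
    apply hM1
    rw [← Measure.restrict_eq_zero, ← ae_eq_bot]
    by_contra hne
    have : (ae (μ.restrict {ω | |M ω| ≠ 1})).NeBot := ⟨hne⟩
    obtain ⟨ω, hω⟩ := h.exists
    have h2 := mul_eq_zero.1 hω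
    rcases h2 with h2 | h2
    · exact absurd (ENNReal.ofReal_eq_zero.1 h2) (not_le.2 (Real.exp_pos _))
    · exact hφ0 _ h2
  have hdec : {ω | M ω = 1} ∪ {ω | M ω = -1} = {ω | |M ω| ≠ 1}ᶜ := by
    ext ω
    simp only [Set.mem_union, Set.mem_ofPred_eq, Set.mem_compl_iff, not_not]
    exact (abs_eq zero_le_one).symm
  have hdisj : Disjoint {ω | M ω = 1} {ω | M ω = -1} :=
    Set.disjoint_left.2 fun ω (h1 : M ω = 1) (h2 : M ω = -1) => by linarith
  have hsum : φ t = ∫⁻ ω in {ω | |M ω| ≠ 1}, F ω ∂μ +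
      (expMomentOn μ M Q 1 t * φ t + expMomentOn μ M Q (-1) t * φ (-t)) := by
    refine hφF.trans ?_
    rw [← lintegral_add_compl F hC, ← hdec, lintegral_union (mset _) hdisj, hset, hset,
      mul_one, mul_neg, mul_one]
  have hfin : expMomentOn μ M Q 1 t * φ t + expMomentOn μ M Q (-1) t * φ (-t) ≠ ∞ := by
    refine ne_top_of_le_ne_top hmom.ne ?_
    show _ ≤ φ t
    exact le_add_self.trans hsum.ge
  show _ < φ t
  refine lt_of_lt_of_eq ?_ hsum.symm
  rw [add_comm (∫⁻ ω in {ω | |M ω| ≠ 1}, F ω ∂μ)]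
  exact ENNReal.lt_add_right hfin hCpos

/-- The unit modulus condition is necessary for exponential moments. -/
theorem IsFixedLaw.unitModulusCond [IsFiniteMeasure μ] [IsProbabilityMeasure ζ]
    (hfix : IsFixedLaw μ M Q ζ) (hM : Measurable M) (hQ : Measurable Q)
    (hM1 : μ {ω | |M ω| ≠ 1} ≠ 0) {s : ℝ} (hs : 0 < s)
    (hmom : ∫⁻ z, ENNReal.ofReal (Real.exp (s * |z|)) ∂ζ < ∞) :
    UnitModulusCond μ M Q s := by
  have hpos : ∫⁻ z, ENNReal.ofReal (Real.exp (s * z)) ∂ζ < ∞ := by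
    refine (lintegral_mono fun z => ENNReal.ofReal_le_ofReal
      (Real.exp_le_exp.2 ?_)).trans_lt hmom
    exact mul_le_mul_of_nonneg_left (le_abs_self z) hs.le
  have hneg : ∫⁻ z, ENNReal.ofReal (Real.exp (-s * z)) ∂ζ < ∞ := by
    refine (lintegral_mono fun z => ENNReal.ofReal_le_ofReal
      (Real.exp_le_exp.2 ?_)).trans_lt hmom
    rw [neg_mul, ← mul_neg]
    exact mul_le_mul_of_nonneg_left (neg_le_abs z) hs.le
  have h1 := hfix.expMomentOn_add_lt hM hQ hM1 hpos
  have h2 := hfix.expMomentOn_add_lt hM hQ hM1 hneg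
  rw [neg_neg] at h2
  exact ENNReal.mul_lt_mul_one_sub_of_add_lt hpos.ne hneg.ne h1 h2

end FixedLaw

/-! ### The unit modulus condition as a tilted moment condition -/

/-- With x = e^u the two requirements say b'/(1 - a') < x < (1 - a)/b, and the hypothesis is that
this interval is nonempty. -/
theorem ENNReal.exists_exp_tilt {a b a' b' : ℝ≥0∞} (ha : a < 1) (ha' : a' < 1)
    (hb : b ≠ ∞) (hb' : b' ≠ ∞) (h : b' * b < (1 - a') * (1 - a)) :
    ∃ u : ℝ, a + ENNReal.ofReal (Real.exp u) * b < 1 ∧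
      a' + ENNReal.ofReal (Real.exp (-u)) * b' < 1 := by
  lift a to NNReal using ha.ne_top
  lift a' to NNReal using ha'.ne_top
  lift b to NNReal using hb
  lift b' to NNReal using hb'
  have ha1 : a < 1 := by exact_mod_cast ha
  have ha1' : a' < 1 := by exact_mod_cast ha'
  have hreal : (b' : ℝ) * b < (1 - a') * (1 - a) := by
    have h2 : b' * b < (1 - a') * (1 - a) := by exact_mod_cast h
    have h3 : ((b' * b : NNReal) : ℝ) < (((1 - a') * (1 - a) : NNReal) : ℝ) := by exact_mod_cast h2
    rwa [NNReal.coe_mul, NNReal.coe_mul, NNReal.coe_sub ha1'.le, NNReal.coe_sub ha1.le] at h3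
  have hA : (a : ℝ) < 1 := by exact_mod_cast ha1
  have hA' : (a' : ℝ) < 1 := by exact_mod_cast ha1'
  obtain ⟨x, hx, hx1, hx2⟩ : ∃ x : ℝ, 0 < x ∧ (a : ℝ) + x * b < 1 ∧ (a' : ℝ) + x⁻¹ * b' < 1 := by
    have p1 : (0 : ℝ) < 1 - a := by linarith
    have p1' : (0 : ℝ) < 1 - a' := by linarith
    have pb : (0 : ℝ) ≤ b := b.coe_nonneg
    have pb' : (0 : ℝ) ≤ b' := b'.coe_nonneg
    rcases pb.eq_or_lt with hb0 | hb0
    -- For b = 0 there is no upper constraint on x.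
    · refine ⟨b' / (1 - a') + 1, by positivity, by rw [← hb0]; linarith, ?_⟩
      have : (b' / (1 - a') + 1 : ℝ)⁻¹ * b' < 1 - a' := by
        rw [inv_mul_lt_iff₀ (by positivity), add_mul, div_mul_cancel₀ _ p1'.ne']
        linarith
      linarith
    · have hlt : (b' : ℝ) / (1 - a') < (1 - a) / b := by
        rw [div_lt_div_iff₀ p1' hb0]; linarith
      obtain ⟨x, h1, h2⟩ := exists_between hlt
      have hx : 0 < x := lt_of_le_of_lt (by positivity) h1
      rw [lt_div_iff₀ hb0] at h2
      rw [div_lt_iff₀ p1'] at h1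
      refine ⟨x, hx, by linarith, ?_⟩
      have : x⁻¹ * b' < 1 - a' := by
        rw [inv_mul_lt_iff₀ hx]; linarith
      linarith
  refine ⟨Real.log x, ?_, ?_⟩
  · rw [Real.exp_log hx, ← ENNReal.ofReal_coe_nnreal, ← ENNReal.ofReal_coe_nnreal,
      ← ENNReal.ofReal_mul hx.le, ← ENNReal.ofReal_add (by positivity) (by positivity)]
    exact ENNReal.ofReal_lt_one.2 hx1
  · rw [Real.exp_neg, Real.exp_log hx, ← ENNReal.ofReal_coe_nnreal, ← ENNReal.ofReal_coe_nnreal,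
      ← ENNReal.ofReal_mul (by positivity), ← ENNReal.ofReal_add (by positivity) (by positivity)]
    exact ENNReal.ofReal_lt_one.2 hx2

section Tilt

variable {Ω : Type*} [MeasurableSpace Ω] {μ : Measure Ω} {M Q : Ω → ℝ}

/-- `E e^{t (Q + d 1_{M = -1})} 1_{|M| = 1}`; note that `(1 - m) / 2` is the indicator of `m = -1`
on `{1, -1}`. -/
noncomputable def tiltMoment (μ : Measure Ω) (M Q : Ω → ℝ) (d t : ℝ) : ℝ≥0∞ :=
  ∫⁻ ω in {ω | |M ω| = 1}, ENNReal.ofReal (Real.exp (t * (Q ω + d * ((1 - M ω) / 2)))) ∂μ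

theorem tiltMoment_eq (hM : Measurable M) (hQ : Measurable Q) (d t : ℝ) :
    tiltMoment μ M Q d t = expMomentOn μ M Q 1 t +
      ENNReal.ofReal (Real.exp (t * d)) * expMomentOn μ M Q (-1) t := by
  have mset : ∀ m : ℝ, MeasurableSet {ω | M ω = m} := fun m => hM (measurableSet_singleton m)
  have hdec : {ω | |M ω| = 1} = {ω | M ω = 1} ∪ {ω | M ω = -1} := by
    ext ω
    simp only [Set.mem_union, Set.mem_ofPred_eq]
    exact abs_eq zero_le_one
  have hdisj : Disjoint {ω | M ω = 1} {ω | M ω = -1} :=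
    Set.disjoint_left.2 fun ω (h1 : M ω = 1) (h2 : M ω = -1) => by linarith
  rw [tiltMoment, hdec, lintegral_union (mset _) hdisj]
  congr 1
  · refine setLIntegral_congr_fun (mset 1) fun ω hω => ?_
    have hω : M ω = 1 := hω
    simp only [hω, sub_self, zero_div, mul_zero, add_zero]
  · rw [expMomentOn, ← lintegral_const_mul _ (by fun_prop)]
    refine setLIntegral_congr_fun (mset (-1)) fun ω hω => ?_
    have hω : M ω = -1 := hω
    simp only [hω]
    rw [← ENNReal.ofReal_mul (Real.exp_pos _).le, ← Real.exp_add]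
    ring_nf

theorem UnitModulusCond.exists_tilt (hM : Measurable M) (hQ : Measurable Q) {s : ℝ} (hs : 0 < s)
    (h : UnitModulusCond μ M Q s) :
    ∃ d, tiltMoment μ M Q d s < 1 ∧ tiltMoment μ M Q d (-s) < 1 := by
  obtain ⟨ha', ha, hb⟩ := h
  -- Both b_+ and b_- vanish exactly when M ≠ -1 almost surely. This excludes 0 · ∞ in the product
  -- b_- b_+, whose finiteness then gives that of each factor.
  have zero_of_zero : ∀ t t' : ℝ, expMomentOn μ M Q (-1) t = 0 → expMomentOn μ M Q (-1) t' = 0 := by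
    intro t t' h
    rw [expMomentOn, lintegral_eq_zero_iff (by fun_prop)] at h ⊢
    filter_upwards [h] with ω hω
    exact absurd (ENNReal.ofReal_eq_zero.1 hω) (not_le.2 (Real.exp_pos _))
  have hfin : expMomentOn μ M Q (-1) (-s) * expMomentOn μ M Q (-1) s ≠ ∞ := hb.ne_top
  have hb1 : expMomentOn μ M Q (-1) s ≠ ∞ := by
    intro htop
    rw [htop] at hfin
    have h0 : expMomentOn μ M Q (-1) (-s) = 0 := by
      by_contra h0; exact hfin (ENNReal.mul_top h0)
    rw [zero_of_zero _ s h0] at htop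
    exact ENNReal.zero_ne_top htop
  have hb2 : expMomentOn μ M Q (-1) (-s) ≠ ∞ := by
    intro htop
    rw [htop] at hfin
    have h0 : expMomentOn μ M Q (-1) s = 0 := by
      by_contra h0; exact hfin (ENNReal.top_mul h0)
    rw [zero_of_zero _ (-s) h0] at htop
    exact ENNReal.zero_ne_top htop
  obtain ⟨u, h1, h2⟩ := ENNReal.exists_exp_tilt ha ha' hb1 hb2 hb
  refine ⟨u / s, ?_, ?_⟩
  · rwa [tiltMoment_eq hM hQ, mul_div_cancel₀ _ hs.ne']
  · rwa [tiltMoment_eq hM hQ, neg_mul, mul_div_cancel₀ _ hs.ne']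

theorem unitModulusCond_of_tilt (hM : Measurable M) (hQ : Measurable Q) {d s : ℝ}
    (h : tiltMoment μ M Q d s < 1) (h' : tiltMoment μ M Q d (-s) < 1) :
    UnitModulusCond μ M Q s := by
  rw [tiltMoment_eq hM hQ] at h h'
  have hy0 : ENNReal.ofReal (Real.exp (s * d)) ≠ 0 :=
    (ENNReal.ofReal_pos.2 (Real.exp_pos _)).ne'
  refine ENNReal.mul_lt_mul_one_sub_of_add_lt (x := 1) (y := ENNReal.ofReal (Real.exp (s * d)))
    ENNReal.one_ne_top ENNReal.ofReal_ne_top ?_ ?_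
  · rwa [mul_one, mul_comm (expMomentOn μ M Q (-1) s)]
  · have h2 := (ENNReal.mul_lt_mul_iff_right hy0 ENNReal.ofReal_ne_top).2 h'
    rw [mul_add, mul_one, ← mul_assoc, ← ENNReal.ofReal_mul (Real.exp_pos _).le, ← Real.exp_add,
      neg_mul, add_neg_cancel, Real.exp_zero, ENNReal.ofReal_one, one_mul] at h2
    rwa [mul_one, mul_comm]

theorem Real.exp_mul_le_convex {θ : ℝ} (h0 : 0 ≤ θ) (h1 : θ ≤ 1) (y : ℝ) :
    Real.exp (θ * y) ≤ (1 - θ) + θ * Real.exp y := by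
  have := convexOn_exp.2 (Set.mem_univ (0 : ℝ)) (Set.mem_univ y) (sub_nonneg.2 h1) h0 (by ring)
  simpa using this

/-- Convexity of exp along the segment from 0 to t; the value at 0 is P(|M| = 1). -/
theorem tiltMoment_mul_le (hM : Measurable M) (hQ : Measurable Q) {θ : ℝ} (h0 : 0 ≤ θ)
    (h1 : θ ≤ 1) (d t : ℝ) :
    tiltMoment μ M Q d (θ * t) ≤ max (μ {ω | |M ω| = 1}) (tiltMoment μ M Q d t) := by
  have hθ : ENNReal.ofReal (1 - θ) + ENNReal.ofReal θ = 1 := by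
    rw [← ENNReal.ofReal_add (sub_nonneg.2 h1) h0, sub_add_cancel, ENNReal.ofReal_one]
  calc tiltMoment μ M Q d (θ * t)
      ≤ ∫⁻ ω in {ω | |M ω| = 1}, (ENNReal.ofReal (1 - θ) + ENNReal.ofReal θ *
          ENNReal.ofReal (Real.exp (t * (Q ω + d * ((1 - M ω) / 2))))) ∂μ := by
        refine lintegral_mono fun ω => ?_
        rw [← ENNReal.ofReal_mul h0,
          ← ENNReal.ofReal_add (sub_nonneg.2 h1) (mul_nonneg h0 (Real.exp_pos _).le), mul_assoc]
        exact ENNReal.ofReal_le_ofReal (Real.exp_mul_le_convex h0 h1 _)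
    _ = ENNReal.ofReal (1 - θ) * μ {ω | |M ω| = 1} +
          ENNReal.ofReal θ * tiltMoment μ M Q d t := by
        rw [lintegral_add_left measurable_const, setLIntegral_const,
          lintegral_const_mul _ (by fun_prop), tiltMoment]
    _ ≤ ENNReal.ofReal (1 - θ) * max (μ {ω | |M ω| = 1}) (tiltMoment μ M Q d t) +
          ENNReal.ofReal θ * max (μ {ω | |M ω| = 1}) (tiltMoment μ M Q d t) := by
        gcongr
        · exact le_max_left _ _
        · exact le_max_right _ _
    _ = _ := by rw [← add_mul, hθ, one_mul]

theorem tiltMoment_le_of_abs_le (hM : Measurable M) (hQ : Measurable Q) {d s t : ℝ} (hs : 0 < s)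
    (ht : |t| ≤ s) :
    tiltMoment μ M Q d t ≤
      max (μ {ω | |M ω| = 1}) (max (tiltMoment μ M Q d s) (tiltMoment μ M Q d (-s))) := by
  have hθ0 : 0 ≤ |t| / s := by positivity
  have hθ1 : |t| / s ≤ 1 := (div_le_one hs).2 ht
  rcases abs_cases t with h | h
  · have e : t = |t| / s * s := by rw [div_mul_cancel₀ _ hs.ne', h.1]
    rw [e]
    exact (tiltMoment_mul_le hM hQ hθ0 hθ1 d s).trans (max_le_max le_rfl (le_max_left _ _))
  · have e : t = |t| / s * -s := by rw [mul_neg, div_mul_cancel₀ _ hs.ne', h.1, neg_neg]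
    rw [e]
    exact (tiltMoment_mul_le hM hQ hθ0 hθ1 d (-s)).trans (max_le_max le_rfl (le_max_right _ _))

/-- The unit modulus condition is inherited by smaller exponents. -/
theorem UnitModulusCond.mono (hM : Measurable M) (hQ : Measurable Q)
    (hM1 : μ {ω | |M ω| = 1} < 1) {s t : ℝ} (ht : 0 < t) (hts : t ≤ s)
    (h : UnitModulusCond μ M Q s) : UnitModulusCond μ M Q t := by
  have hs := ht.trans_le hts
  obtain ⟨d, h1, h2⟩ := h.exists_tilt hM hQ hs
  have key : ∀ u : ℝ, |u| ≤ s → tiltMoment μ M Q d u < 1 := fun u hu =>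
    (tiltMoment_le_of_abs_le hM hQ hs hu).trans_lt (max_lt hM1 (max_lt h1 h2))
  exact unitModulusCond_of_tilt (d := d) hM hQ (key t (by rwa [abs_of_pos ht]))
    (key (-t) (by rwa [abs_neg, abs_of_pos ht]))

end Tilt

/-! ### Construction of the supersolution -/

section Supersolution

/-- Logarithm of the weight that turns `Q` into `Q + d 1_{M = -1}` on `{|M| = 1}`. -/
noncomputable def signWeight (d x : ℝ) : ℝ := d * max (-x) 0

theorem measurable_signWeight (d : ℝ) : Measurable (signWeight d) := by
  unfold signWeight; fun_prop

theorem abs_signWeight_le (d x : ℝ) : |signWeight d x| ≤ |d| * |x| := by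
  rw [signWeight, abs_mul, abs_of_nonneg (le_max_right (-x) 0)]
  exact mul_le_mul_of_nonneg_left (max_le (neg_le_abs x) (abs_nonneg x)) (abs_nonneg d)

/-- The tilt is a coboundary: on |M| = 1 the weight e^{`signWeight`} at tM over that at t is exactly
e^{td 1_{M=-1}}, for either sign of t. -/
theorem signWeight_mul_sub {m : ℝ} (hm : |m| = 1) (d t : ℝ) :
    signWeight d (t * m) - signWeight d t = t * (d * ((1 - m) / 2)) := by
  rcases (abs_eq zero_le_one).1 hm with rfl | rfl
  · simp
  · simp only [signWeight, mul_neg, mul_one, neg_neg]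
    rcases le_total 0 t with h | h
    · rw [max_eq_left h, max_eq_right (by linarith : -t ≤ 0)]; ring
    · rw [max_eq_right h, max_eq_left (by linarith : 0 ≤ -t)]; ring

theorem signWeight_sub_le {m : ℝ} (hm : |m| ≤ 1) (d t : ℝ) :
    signWeight d (t * m) - signWeight d t ≤ |t| * (2 * |d|) := by
  have h1 := le_trans (le_abs_self _) (abs_signWeight_le d (t * m))
  have h2 := le_trans (neg_le_abs _) (abs_signWeight_le d t)
  have h3 : |d| * |t * m| ≤ |d| * |t| := by
    rw [abs_mul]
    exact mul_le_mul_of_nonneg_left (mul_le_of_le_one_right (abs_nonneg t) hm) (abs_nonneg d)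
  linarith

variable {Ω : Type*} [MeasurableSpace Ω] {μ : Measure Ω} {M Q : Ω → ℝ}

theorem lintegral_ofReal_abs_lt_one [IsProbabilityMeasure μ] (hM : Measurable M)
    (hM1 : ∀ᵐ ω ∂μ, |M ω| ≤ 1) (hlt : μ {ω | |M ω| = 1} < 1) :
    ∫⁻ ω, ENNReal.ofReal |M ω| ∂μ < 1 := by
  have hle : ∀ᵐ ω ∂μ, ENNReal.ofReal |M ω| ≤ 1 := by
    filter_upwards [hM1] with ω h using ENNReal.ofReal_le_one.2 h
  have hle1 : ∫⁻ ω, ENNReal.ofReal |M ω| ∂μ ≤ 1 := by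
    simpa using lintegral_mono_ae hle
  refine lt_of_le_of_ne hle1 fun heq => ?_
  have := ae_eq_of_ae_le_of_lintegral_le hle (by rw [heq]; exact ENNReal.one_ne_top)
    (g := fun _ => (1 : ℝ≥0∞)) aemeasurable_const (by rw [heq]; simp)
  have h1 : ∀ᵐ ω ∂μ, |M ω| = 1 := by
    filter_upwards [this] with ω h
    have h := congrArg ENNReal.toReal h
    simpa [ENNReal.toReal_ofReal (abs_nonneg _)] using h
  have h2 : μ {ω | |M ω| = 1} = 1 :=
    (mem_ae_iff_prob_eq_one (measurableSet_eq_fun (by fun_prop) measurable_const)).1 h1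
  exact hlt.ne h2

/-- Finiteness of `E e^{s |Q|}` in the form used for dominated convergence. -/
theorem lintegral_exp_add_lt_top {s : ℝ} (hmom : expAbsMoment μ Q s < ∞) (a : ℝ) :
    ∫⁻ ω, ENNReal.ofReal (Real.exp (s * (|Q ω| + a))) ∂μ < ∞ := by
  have : ∀ ω, ENNReal.ofReal (Real.exp (s * (|Q ω| + a))) =
      ENNReal.ofReal (Real.exp (s * |Q ω|)) * ENNReal.ofReal (Real.exp (s * a)) := fun ω => by
    rw [← ENNReal.ofReal_mul (Real.exp_pos _).le, ← Real.exp_add, mul_add]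
  simp_rw [this]
  rw [lintegral_mul_const' _ _ ENNReal.ofReal_ne_top]
  exact ENNReal.mul_lt_top hmom ENNReal.ofReal_lt_top

theorem exists_lintegral_abs_mul_exp_lt_one [IsProbabilityMeasure μ] (hM : Measurable M)
    (hQ : Measurable Q) (hM1 : ∀ᵐ ω ∂μ, |M ω| ≤ 1) (hlt : μ {ω | |M ω| = 1} < 1) {s : ℝ}
    (hs : 0 < s) (hmom : expAbsMoment μ Q s < ∞) {a : ℝ} (ha : 0 ≤ a) :
    ∃ τ, 0 < τ ∧ τ ≤ s ∧
      ∫⁻ ω, ENNReal.ofReal (|M ω| * Real.exp (τ * (|Q ω| + a))) ∂μ < 1 := by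
  have hτ : Tendsto (fun n : ℕ => s * (1 / ((n : ℝ) + 1))) atTop (𝓝 0) := by
    simpa using tendsto_one_div_add_atTop_nhds_zero_nat.const_mul s
  have hτle : ∀ n : ℕ, s * (1 / ((n : ℝ) + 1)) ≤ s := fun n => by
    refine mul_le_of_le_one_right hs.le ?_
    rw [div_le_one (by positivity)]
    have : (0 : ℝ) ≤ n := n.cast_nonneg
    linarith
  have lim : Tendsto (fun n : ℕ => ∫⁻ ω, ENNReal.ofReal
      (|M ω| * Real.exp (s * (1 / ((n : ℝ) + 1)) * (|Q ω| + a))) ∂μ) atTop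
      (𝓝 (∫⁻ ω, ENNReal.ofReal |M ω| ∂μ)) := by
    refine tendsto_lintegral_of_dominated_convergence
      (fun ω => ENNReal.ofReal (Real.exp (s * (|Q ω| + a)))) (fun n => by fun_prop) ?_
      (lintegral_exp_add_lt_top hmom a).ne ?_
    · intro n
      filter_upwards [hM1] with ω hω
      refine ENNReal.ofReal_le_ofReal ((mul_le_of_le_one_left (Real.exp_pos _).le hω).trans ?_)
      exact Real.exp_le_exp.2 (mul_le_mul_of_nonneg_right (hτle n) (by positivity))
    · refine ae_of_all _ fun ω => ENNReal.tendsto_ofReal ?_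
      have h := (Real.continuous_exp.tendsto _).comp (hτ.mul_const (|Q ω| + a))
      simpa using h.const_mul |M ω|
  obtain ⟨n, hn⟩ := (lim.eventually_lt_const (lintegral_ofReal_abs_lt_one hM hM1 hlt)).exists
  exact ⟨_, by positivity, hτle n, hn⟩

theorem tendsto_setLIntegral_exp_sub [IsProbabilityMeasure μ] (hM : Measurable M)
    (hQ : Measurable Q) {s : ℝ} (hmom : expAbsMoment μ Q s < ∞)
    (hM1 : ∀ᵐ ω ∂μ, |M ω| ≤ 1) (a : ℝ) {τ : ℝ} (hτ : 0 < τ) :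
    Tendsto (fun n : ℕ => ∫⁻ ω in {ω | |M ω| ≠ 1}, ENNReal.ofReal
      (Real.exp (s * (|Q ω| + a) - n * (τ * (1 - |M ω|)))) ∂μ) atTop (𝓝 0) := by
  have hC : MeasurableSet {ω | |M ω| ≠ 1} :=
    (measurableSet_eq_fun (by fun_prop) measurable_const).compl
  have hfin := ((setLIntegral_le_lintegral {ω | |M ω| ≠ 1} _).trans_lt
    (lintegral_exp_add_lt_top hmom a)).ne
  have := tendsto_lintegral_of_dominated_convergence (μ := μ.restrict {ω | |M ω| ≠ 1})
    (F := fun (n : ℕ) ω => ENNReal.ofReal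
      (Real.exp (s * (|Q ω| + a) - n * (τ * (1 - |M ω|))))) (f := 0)
    (fun ω => ENNReal.ofReal (Real.exp (s * (|Q ω| + a)))) (fun n => by fun_prop) ?_ hfin ?_
  · simpa using this
  · intro n
    filter_upwards [ae_restrict_of_ae hM1] with ω hω
    refine ENNReal.ofReal_le_ofReal (Real.exp_le_exp.2 ?_)
    have : 0 ≤ n * (τ * (1 - |M ω|)) := by
      have : 0 ≤ 1 - |M ω| := by linarith
      positivity
    linarith
  · filter_upwards [ae_restrict_of_ae hM1, ae_restrict_mem hC] with ω h1 h2
    have h3 : 0 < τ * (1 - |M ω|) := mul_pos hτ (sub_pos.2 (lt_of_le_of_ne h1 h2))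
    have h4 : Tendsto (fun n : ℕ => s * (|Q ω| + a) - n * (τ * (1 - |M ω|))) atTop atBot := by
      simp only [sub_eq_add_neg]
      refine tendsto_atBot_add_const_left _ _ (tendsto_neg_atTop_atBot.comp ?_)
      exact tendsto_natCast_atTop_atTop.atTop_mul_const h3
    have h5 := ENNReal.tendsto_ofReal (Real.tendsto_exp_atBot.comp h4)
    simpa using h5

/-- For |t| ≤ τ the exponential is close to 1 and E|M| < 1 suffices. For τ ≤ |t| ≤ s, the part |M| =
1 is a tilted moment, at most ρ₀ < 1, and a large l makes the part |M| < 1 smaller than 1 - ρ₀. Thus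
τ is fixed before l. -/
theorem exists_contraction_weight [IsProbabilityMeasure μ] (hM : Measurable M)
    (hQ : Measurable Q) (hM1 : ∀ᵐ ω ∂μ, |M ω| ≤ 1) (hlt : μ {ω | |M ω| = 1} < 1) {s : ℝ}
    (hs : 0 < s) (hmom : expAbsMoment μ Q s < ∞) {d : ℝ} (hd : tiltMoment μ M Q d s < 1)
    (hd' : tiltMoment μ M Q d (-s) < 1) :
    ∃ l : ℝ, 0 ≤ l ∧ ∃ ρ : ℝ≥0∞, ρ < 1 ∧ ∀ t : ℝ, |t| ≤ s →
      ∫⁻ ω, ENNReal.ofReal (|M ω| * Real.exp (t * Q ω +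
        (signWeight d (t * M ω) - signWeight d t) - l * (|t| * (1 - |M ω|)))) ∂μ ≤ ρ := by
  obtain ⟨τ, hτ, hτs, hsmall⟩ := exists_lintegral_abs_mul_exp_lt_one hM hQ hM1 hlt hs hmom
    (a := 2 * |d|) (by positivity)
  set ρ₀ := max (μ {ω | |M ω| = 1}) (max (tiltMoment μ M Q d s) (tiltMoment μ M Q d (-s)))
    with hρ₀
  have hρ₀1 : ρ₀ < 1 := max_lt hlt (max_lt hd hd')
  have lim := (tendsto_setLIntegral_exp_sub hM hQ hmom hM1 (2 * |d|) hτ).const_add ρ₀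
  rw [add_zero] at lim
  obtain ⟨n, hn⟩ := (lim.eventually_lt_const hρ₀1).exists
  refine ⟨n, n.cast_nonneg, _, max_lt hsmall hn, fun t ht => ?_⟩
  have hexp : ∀ ω, |M ω| ≤ 1 → t * Q ω + (signWeight d (t * M ω) - signWeight d t) ≤
      |t| * (|Q ω| + 2 * |d|) := fun ω hω => by
    have h1 := signWeight_sub_le hω d t
    have h2 : t * Q ω ≤ |t| * |Q ω| := by rw [← abs_mul]; exact le_abs_self _
    linarith
  rcases le_total |t| τ with htτ | htτ
  · refine le_trans (lintegral_mono_ae ?_) (le_max_left _ _)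
    filter_upwards [hM1] with ω hω
    refine ENNReal.ofReal_le_ofReal (mul_le_mul_of_nonneg_left
      (Real.exp_le_exp.2 ?_) (abs_nonneg _))
    have h1 : 0 ≤ n * (|t| * (1 - |M ω|)) := by
      have : 0 ≤ 1 - |M ω| := by linarith
      positivity
    have h2 : |t| * (|Q ω| + 2 * |d|) ≤ τ * (|Q ω| + 2 * |d|) :=
      mul_le_mul_of_nonneg_right htτ (by positivity)
    have := hexp ω hω
    linarith
  · refine le_trans ?_ (le_max_right _ _)
    have hC : MeasurableSet {ω | |M ω| = 1} := measurableSet_eq_fun (by fun_prop) measurable_const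
    rw [← lintegral_add_compl _ hC]
    refine add_le_add (le_trans ?_ (tiltMoment_le_of_abs_le hM hQ hs ht)) ?_
    · refine setLIntegral_mono (by fun_prop) fun ω hω => ?_
      have hω : |M ω| = 1 := hω
      rw [signWeight_mul_sub hω, hω]
      refine ENNReal.ofReal_le_ofReal (le_of_eq ?_)
      ring_nf
    · refine lintegral_mono_ae ?_
      filter_upwards [ae_restrict_of_ae hM1] with ω hω
      refine ENNReal.ofReal_le_ofReal ((mul_le_of_le_one_left (Real.exp_pos _).le hω).trans
        (Real.exp_le_exp.2 ?_))
      have h0 : 0 ≤ 1 - |M ω| := by linarith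
      have h1 : n * (τ * (1 - |M ω|)) ≤ n * (|t| * (1 - |M ω|)) := by gcongr
      have h2 : |t| * (|Q ω| + 2 * |d|) ≤ s * (|Q ω| + 2 * |d|) :=
        mul_le_mul_of_nonneg_right ht (by positivity)
      have := hexp ω hω
      linarith

/-- Under the unit modulus condition there is `h ≥ 1` with
`E e^{t Q} h (t M) ≤ h t` for `|t| ≤ s`. -/
theorem UnitModulusCond.exists_supersolution [IsProbabilityMeasure μ] (hM : Measurable M)
    (hQ : Measurable Q) (hM1 : ∀ᵐ ω ∂μ, |M ω| ≤ 1) (hlt : μ {ω | |M ω| = 1} < 1) {s : ℝ}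
    (hs : 0 < s) (hmom : expAbsMoment μ Q s < ∞) (hcond : UnitModulusCond μ M Q s) :
    ∃ h : ℝ → ℝ, Measurable h ∧ (∀ t, 1 ≤ h t) ∧ ∀ t : ℝ, |t| ≤ s →
      ∫⁻ ω, ENNReal.ofReal (Real.exp (t * Q ω) * h (t * M ω)) ∂μ ≤ ENNReal.ofReal (h t) := by
  obtain ⟨d, hd, hd'⟩ := hcond.exists_tilt hM hQ hs
  obtain ⟨l, hl, ρ, hρ, hcontr⟩ := exists_contraction_weight hM hQ hM1 hlt hs hmom hd hd'
  set C : ℝ≥0∞ := ∫⁻ ω, ENNReal.ofReal ((Real.exp (s * |Q ω|) - 1) / s) ∂μ with hC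
  have hCf : C ≠ ∞ := by
    have h1 : C ≤ ∫⁻ ω, ENNReal.ofReal (Real.exp (s * |Q ω|)) * ENNReal.ofReal (1 / s) ∂μ := by
      refine lintegral_mono fun ω => ?_
      rw [← ENNReal.ofReal_mul (Real.exp_pos _).le]
      refine ENNReal.ofReal_le_ofReal ?_
      rw [mul_one_div]
      exact div_le_div_of_nonneg_right (by linarith) hs.le
    rw [lintegral_mul_const' _ _ ENNReal.ofReal_ne_top] at h1
    exact (h1.trans_lt (ENNReal.mul_lt_top hmom ENNReal.ofReal_lt_top)).ne
  have hr1 : ρ.toReal < 1 := by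
    have := (ENNReal.toReal_lt_toReal hρ.ne_top ENNReal.one_ne_top).2 hρ
    simpa using this
  -- For h(t) = 1 + K|t|g(t), one has E e^{tQ} ≤ 1 + C|t|, while the other term contracts by ρ. So C
  -- ≤ K(1 - ρ)g(t) is enough, and g(t) ≥ e^{-|d|s} determines K. The factor |t| produces the |M| of
  -- the contraction estimate.
  set K : ℝ := C.toReal * Real.exp (|d| * s) / (1 - ρ.toReal) with hK
  have hK0 : 0 ≤ K := div_nonneg (by positivity) (by linarith)
  set g : ℝ → ℝ := fun t => Real.exp (l * |t| + signWeight d t) with hg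
  have hgm : Measurable g := by
    have := measurable_signWeight d
    fun_prop
  refine ⟨fun t => 1 + K * |t| * g t, by fun_prop, fun t => ?_, fun t ht => ?_⟩
  · have : 0 ≤ K * |t| * g t := by positivity
    linarith
  have hsplit : ∀ ω, ENNReal.ofReal (Real.exp (t * Q ω) * (1 + K * |t * M ω| * g (t * M ω))) =
      ENNReal.ofReal (Real.exp (t * Q ω)) + ENNReal.ofReal (K * |t| * g t) *
        ENNReal.ofReal (|M ω| * Real.exp (t * Q ω +
        (signWeight d (t * M ω) - signWeight d t) - l * (|t| * (1 - |M ω|)))) := by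
    intro ω
    rw [← ENNReal.ofReal_mul (by positivity), ← ENNReal.ofReal_add (by positivity) (by positivity)]
    congr 1
    have e : g t * Real.exp (t * Q ω + (signWeight d (t * M ω) - signWeight d t) -
        l * (|t| * (1 - |M ω|))) = Real.exp (t * Q ω) * g (t * M ω) := by
      simp only [hg]
      rw [← Real.exp_add, ← Real.exp_add, abs_mul]
      ring_nf
    calc Real.exp (t * Q ω) * (1 + K * |t * M ω| * g (t * M ω))
        = Real.exp (t * Q ω) + K * |t| * |M ω| * (Real.exp (t * Q ω) * g (t * M ω)) := by
          rw [abs_mul]; ring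
      _ = _ := by rw [← e]; ring
  have hfirst : ∫⁻ ω, ENNReal.ofReal (Real.exp (t * Q ω)) ∂μ ≤ 1 + ENNReal.ofReal |t| * C := by
    calc ∫⁻ ω, ENNReal.ofReal (Real.exp (t * Q ω)) ∂μ
        ≤ ∫⁻ ω, (1 + ENNReal.ofReal |t| *
            ENNReal.ofReal ((Real.exp (s * |Q ω|) - 1) / s)) ∂μ := by
          refine lintegral_mono fun ω => ?_
          have h0 : 0 ≤ Real.exp (s * |Q ω|) - 1 :=
            sub_nonneg.2 (Real.one_le_exp (by positivity))
          rw [← ENNReal.ofReal_mul (abs_nonneg t), ← ENNReal.ofReal_one,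
            ← ENNReal.ofReal_add zero_le_one (by positivity)]
          refine ENNReal.ofReal_le_ofReal ?_
          have h1 := Real.exp_mul_le_convex (θ := |t| / s) (by positivity)
            ((div_le_one hs).2 ht) (s * |Q ω|)
          have h2 : t * Q ω ≤ |t| / s * (s * |Q ω|) := by
            rw [← mul_assoc, div_mul_cancel₀ _ hs.ne', ← abs_mul]
            exact le_abs_self _
          refine (Real.exp_le_exp.2 h2).trans (h1.trans (le_of_eq ?_))
          field_simp
          ring
      _ = _ := by
          rw [lintegral_add_left measurable_const, lintegral_const_mul _ (by fun_prop)]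
          simp [hC]
  have hgm' : Measurable (signWeight d) := measurable_signWeight d
  show ∫⁻ ω, ENNReal.ofReal (Real.exp (t * Q ω) * (1 + K * |t * M ω| * g (t * M ω))) ∂μ ≤
    ENNReal.ofReal (1 + K * |t| * g t)
  simp_rw [hsplit]
  rw [lintegral_add_left (by fun_prop), lintegral_const_mul _ (by fun_prop)]
  refine (add_le_add hfirst (mul_le_mul_right (hcontr t ht) _)).trans ?_
  rw [← ENNReal.ofReal_toReal hCf, ← ENNReal.ofReal_toReal hρ.ne_top, ← ENNReal.ofReal_one,
    ← ENNReal.ofReal_mul (abs_nonneg t), ← ENNReal.ofReal_mul (by positivity),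
    ← ENNReal.ofReal_add zero_le_one (by positivity),
    ← ENNReal.ofReal_add (by positivity) (by positivity)]
  refine ENNReal.ofReal_le_ofReal ?_
  have hge : Real.exp (-(|d| * s)) ≤ g t := by
    refine Real.exp_le_exp.2 ?_
    have h1 := (abs_le.1 (abs_signWeight_le d t)).1
    have h2 : |d| * |t| ≤ |d| * s := mul_le_mul_of_nonneg_left ht (abs_nonneg d)
    have h3 : 0 ≤ l * |t| := by positivity
    linarith
  have hCK : C.toReal ≤ K * (1 - ρ.toReal) * g t := by
    rw [hK, div_mul_cancel₀ _ (by linarith)]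
    calc C.toReal = C.toReal * Real.exp (|d| * s) * Real.exp (-(|d| * s)) := by
          rw [mul_assoc, ← Real.exp_add, add_neg_cancel, Real.exp_zero, mul_one]
      _ ≤ _ := by gcongr
  have := mul_le_mul_of_nonneg_left hCK (abs_nonneg t)
  linarith

end Supersolution

/-! ### Elementary bounds by exponential moments -/

section AbsMoment

variable {Ω : Type*} [MeasurableSpace Ω] {μ : Measure Ω}

theorem lintegral_abs_lt_top_of_expAbsMoment {X : Ω → ℝ} {s : ℝ} (hs : 0 < s)
    (h : expAbsMoment μ X s < ∞) : ∫⁻ ω, ENNReal.ofReal |X ω| ∂μ < ∞ := by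
  have h1 : ∫⁻ ω, ENNReal.ofReal |X ω| ∂μ ≤
      ∫⁻ ω, ENNReal.ofReal (1 / s) * ENNReal.ofReal (Real.exp (s * |X ω|)) ∂μ := by
    refine lintegral_mono fun ω => ?_
    rw [← ENNReal.ofReal_mul (by positivity)]
    refine ENNReal.ofReal_le_ofReal ?_
    rw [one_div, le_inv_mul_iff₀ hs]
    linarith [Real.add_one_le_exp (s * |X ω|)]
  rw [lintegral_const_mul' _ _ ENNReal.ofReal_ne_top] at h1
  exact h1.trans_lt (ENNReal.mul_lt_top ENNReal.ofReal_lt_top h)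

theorem expAbsMoment_mono {X : Ω → ℝ} {r s : ℝ} (h : r ≤ s) :
    expAbsMoment μ X r ≤ expAbsMoment μ X s :=
  lintegral_mono fun _ => ENNReal.ofReal_le_ofReal
    (Real.exp_le_exp.2 (mul_le_mul_of_nonneg_right h (abs_nonneg _)))

end AbsMoment

/-! ### Convergence and exponential moments of the perpetuity -/

section Iid

variable {Ω : Type*} [MeasurableSpace Ω] {μ : Measure Ω} [IsProbabilityMeasure μ]
  {M Q : ℕ → Ω → ℝ}

/-- (Z_n, Π_n) depends only on the first n pairs, so the next pair can be integrated out first as a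
fresh copy. -/
theorem lintegral_perpSum_prod_eq (hM : ∀ n, Measurable (M n)) (hQ : ∀ n, Measurable (Q n))
    (hindep : iIndepFun (fun n ω => (M n ω, Q n ω)) μ)
    (hident : ∀ n, IdentDistrib (fun ω => (M n ω, Q n ω)) (fun ω => (M 0 ω, Q 0 ω)) μ μ)
    (n : ℕ) {F : (ℝ × ℝ) × (ℝ × ℝ) → ℝ≥0∞} (hF : Measurable F) :
    ∫⁻ ω, F ((perpSum M Q n ω, ∏ j ∈ Finset.range n, M j ω), (M n ω, Q n ω)) ∂μ =
      ∫⁻ ω, ∫⁻ ω', F ((perpSum M Q n ω, ∏ j ∈ Finset.range n, M j ω), (M 0 ω', Q 0 ω')) ∂μ ∂μ := by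
  have hMQ : ∀ n, Measurable fun ω => (M n ω, Q n ω) := fun n => (hM n).prodMk (hQ n)
  have hX : Measurable fun ω => (perpSum M Q n ω, ∏ j ∈ Finset.range n, M j ω) :=
    (measurable_perpSum hM hQ n).prodMk (by fun_prop)
  have hind : IndepFun (fun ω => (perpSum M Q n ω, ∏ j ∈ Finset.range n, M j ω))
      (fun ω => (M n ω, Q n ω)) μ := by
    refine hindep.indepFun_of_dependsOn hMQ (S := Set.Iio n) (T := {n}) (by simp)
      (φ := fun x => (perpSum (fun k (x : ℕ → ℝ × ℝ) => (x k).1) (fun k x => (x k).2) n x,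
        ∏ j ∈ Finset.range n, (x j).1)) (ψ := fun x => x n)
      ((measurable_perpSum (fun k => by fun_prop) (fun k => by fun_prop) n).prodMk
        (by fun_prop)) (measurable_pi_apply n) ?_ ?_
    · intro x y h
      have hxy : ∀ k < n, x k = y k := fun k hk => h k hk
      refine Prod.ext ?_ ?_
      · dsimp only [perpSum]
        refine Finset.sum_congr rfl fun k hk => ?_
        rw [Finset.mem_range] at hk
        rw [hxy k hk]
        congr 1
        refine Finset.prod_congr rfl fun j hj => ?_
        rw [hxy j ((Finset.mem_range.1 hj).trans hk)]
      · show ∏ j ∈ Finset.range n, (x j).1 = ∏ j ∈ Finset.range n, (y j).1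
        exact Finset.prod_congr rfl fun j hj => by rw [hxy j (Finset.mem_range.1 hj)]
    · intro x y h
      exact h n rfl
  rw [hind.lintegral_prodMk hX (hMQ n) hF, (hident n).map_eq]
  refine lintegral_congr fun ω => ?_
  rw [lintegral_map (by fun_prop) (hMQ 0)]

theorem lintegral_prod_abs_eq (hM : ∀ n, Measurable (M n)) (hQ : ∀ n, Measurable (Q n))
    (hindep : iIndepFun (fun n ω => (M n ω, Q n ω)) μ)
    (hident : ∀ n, IdentDistrib (fun ω => (M n ω, Q n ω)) (fun ω => (M 0 ω, Q 0 ω)) μ μ) (n : ℕ) :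
    ∫⁻ ω, ENNReal.ofReal |∏ j ∈ Finset.range n, M j ω| ∂μ =
      (∫⁻ ω, ENNReal.ofReal |M 0 ω| ∂μ) ^ n := by
  induction n with
  | zero => simp
  | succ n ih =>
    have h := lintegral_perpSum_prod_eq hM hQ hindep hident n
      (F := fun p => ENNReal.ofReal |p.1.2| * ENNReal.ofReal |p.2.1|) (by fun_prop)
    simp_rw [Finset.prod_range_succ, abs_mul, ENNReal.ofReal_mul (abs_nonneg _)]
    have hm := hM 0
    refine h.trans ?_
    simp only
    simp_rw [lintegral_const_mul' _ _ ENNReal.ofReal_ne_top]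
    rw [lintegral_mul_const _ (by fun_prop), ih, pow_succ]

/-- If `|M| ≤ 1` and `E |Q| < ∞`, the perpetuity converges absolutely. -/
theorem exists_isPerpetuity (hM : ∀ n, Measurable (M n)) (hQ : ∀ n, Measurable (Q n))
    (hindep : iIndepFun (fun n ω => (M n ω, Q n ω)) μ)
    (hident : ∀ n, IdentDistrib (fun ω => (M n ω, Q n ω)) (fun ω => (M 0 ω, Q 0 ω)) μ μ)
    (hm : ∫⁻ ω, ENNReal.ofReal |M 0 ω| ∂μ < 1) (hq : ∫⁻ ω, ENNReal.ofReal |Q 0 ω| ∂μ < ∞) :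
    ∃ Z : Ω → ℝ, IsPerpetuity μ M Q Z := by
  have hterm : ∀ n, ∫⁻ ω, ENNReal.ofReal |(∏ j ∈ Finset.range n, M j ω) * Q n ω| ∂μ =
      (∫⁻ ω, ENNReal.ofReal |M 0 ω| ∂μ) ^ n * ∫⁻ ω, ENNReal.ofReal |Q 0 ω| ∂μ := by
    intro n
    have h := lintegral_perpSum_prod_eq hM hQ hindep hident n
      (F := fun p => ENNReal.ofReal |p.1.2| * ENNReal.ofReal |p.2.2|) (by fun_prop)
    simp_rw [abs_mul, ENNReal.ofReal_mul (abs_nonneg _)]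
    refine h.trans ?_
    simp only
    simp_rw [lintegral_const_mul' _ _ ENNReal.ofReal_ne_top]
    rw [lintegral_mul_const _ (by fun_prop), lintegral_prod_abs_eq hM hQ hindep hident]
  have hsum : ∫⁻ ω, ∑' n, ENNReal.ofReal |(∏ j ∈ Finset.range n, M j ω) * Q n ω| ∂μ ≠ ∞ := by
    rw [lintegral_tsum fun n => by fun_prop]
    simp_rw [hterm]
    rw [ENNReal.tsum_mul_right, ENNReal.tsum_geometric]
    exact ENNReal.mul_ne_top (ENNReal.inv_ne_top.2 (tsub_pos_of_lt hm).ne') hq.ne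
  refine ⟨fun ω => ∑' n, (∏ j ∈ Finset.range n, M j ω) * Q n ω, ?_⟩
  filter_upwards [ae_lt_top (by fun_prop) hsum] with ω hω
  have h1 : Summable fun n => |(∏ j ∈ Finset.range n, M j ω) * Q n ω| :=
    (ENNReal.summable_toReal hω.ne).congr fun n => ENNReal.toReal_ofReal (abs_nonneg _)
  exact h1.of_abs.hasSum.tendsto_sum_nat

/-- The exponential supermartingale estimate for the partial sums. -/
theorem lintegral_exp_perpSum_mul_le (hM : ∀ n, Measurable (M n)) (hQ : ∀ n, Measurable (Q n))
    (hindep : iIndepFun (fun n ω => (M n ω, Q n ω)) μ)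
    (hident : ∀ n, IdentDistrib (fun ω => (M n ω, Q n ω)) (fun ω => (M 0 ω, Q 0 ω)) μ μ)
    (hM1 : ∀ᵐ ω ∂μ, |M 0 ω| ≤ 1) {s : ℝ} {h : ℝ → ℝ} (hh : Measurable h)
    (hsup : ∀ t : ℝ, |t| ≤ s → ∫⁻ ω, ENNReal.ofReal (Real.exp (t * Q 0 ω) * h (t * M 0 ω)) ∂μ ≤
      ENNReal.ofReal (h t)) {t : ℝ} (ht : |t| ≤ s) (n : ℕ) :
    ∫⁻ ω, ENNReal.ofReal (Real.exp (t * perpSum M Q n ω) *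
      h (t * ∏ j ∈ Finset.range n, M j ω)) ∂μ ≤ ENNReal.ofReal (h t) := by
  have hall : ∀ᵐ ω ∂μ, ∀ n, |M n ω| ≤ 1 := by
    refine ae_all_iff.2 fun n => ?_
    have hs : MeasurableSet {p : ℝ × ℝ | |p.1| ≤ 1} :=
      measurableSet_le (by fun_prop) measurable_const
    exact (hident n).symm.ae_snd (p := fun p : ℝ × ℝ => |p.1| ≤ 1) hs hM1
  induction n with
  | zero => simp [perpSum]
  | succ n ih =>
    refine le_trans ?_ ih
    have hrec := lintegral_perpSum_prod_eq hM hQ hindep hident n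
      (F := fun p => ENNReal.ofReal (Real.exp (t * p.1.1) *
        (Real.exp (t * p.1.2 * p.2.2) * h (t * p.1.2 * p.2.1)))) (by fun_prop)
    have e : ∀ ω, ENNReal.ofReal (Real.exp (t * perpSum M Q (n + 1) ω) *
        h (t * ∏ j ∈ Finset.range (n + 1), M j ω)) =
        ENNReal.ofReal (Real.exp (t * perpSum M Q n ω) *
          (Real.exp (t * (∏ j ∈ Finset.range n, M j ω) * Q n ω) *
            h (t * (∏ j ∈ Finset.range n, M j ω) * M n ω))) := by
      intro ω
      rw [← mul_assoc (Real.exp _), ← Real.exp_add, perpSum, Finset.sum_range_succ,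
        Finset.prod_range_succ, ← perpSum]
      ring_nf
    simp_rw [e]
    refine hrec.trans_le (lintegral_mono_ae ?_)
    filter_upwards [hall] with ω hω
    simp_rw [ENNReal.ofReal_mul (Real.exp_pos (t * perpSum M Q n ω)).le]
    rw [lintegral_const_mul' _ _ ENNReal.ofReal_ne_top]
    -- The supersolution inequality is used at tΠ_n, which stays in [-s, s] because every |M_j| ≤ 1.
    refine mul_le_mul_right (hsup _ ?_) _
    rw [abs_mul, Finset.abs_prod]
    exact (mul_le_of_le_one_right (abs_nonneg t)
      (Finset.prod_le_one (fun j _ => abs_nonneg _) fun j _ => hω j)).trans ht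

/-- As h ≥ 1, the supermartingale estimate bounds E e^{tZ_n} uniformly in n, and Fatou's lemma
passes to Z. -/
theorem IsPerpetuity.expAbsMoment_lt_top {Z : Ω → ℝ} (hZ : IsPerpetuity μ M Q Z)
    (hM : ∀ n, Measurable (M n)) (hQ : ∀ n, Measurable (Q n))
    (hindep : iIndepFun (fun n ω => (M n ω, Q n ω)) μ)
    (hident : ∀ n, IdentDistrib (fun ω => (M n ω, Q n ω)) (fun ω => (M 0 ω, Q 0 ω)) μ μ)
    (hM1 : ∀ᵐ ω ∂μ, |M 0 ω| ≤ 1) (hlt : μ {ω | |M 0 ω| = 1} < 1) {s : ℝ}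
    (hs : 0 < s) (hmom : expAbsMoment μ (Q 0) s < ∞) (hcond : UnitModulusCond μ (M 0) (Q 0) s) :
    expAbsMoment μ Z s < ∞ := by
  obtain ⟨h, hh, hh1, hsup⟩ := hcond.exists_supersolution (hM 0) (hQ 0) hM1 hlt hs hmom
  have bound : ∀ t : ℝ, |t| ≤ s → ∫⁻ ω, ENNReal.ofReal (Real.exp (t * Z ω)) ∂μ ≤
      ENNReal.ofReal (h t) := by
    intro t ht
    have hn : ∀ n, ∫⁻ ω, ENNReal.ofReal (Real.exp (t * perpSum M Q n ω)) ∂μ ≤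
        ENNReal.ofReal (h t) := fun n =>
      (lintegral_mono fun ω => ENNReal.ofReal_le_ofReal
        (le_mul_of_one_le_right (Real.exp_pos _).le (hh1 _))).trans
        (lintegral_exp_perpSum_mul_le hM hQ hindep hident hM1 hh hsup ht n)
    calc ∫⁻ ω, ENNReal.ofReal (Real.exp (t * Z ω)) ∂μ
        = ∫⁻ ω, liminf (fun n => ENNReal.ofReal (Real.exp (t * perpSum M Q n ω))) atTop ∂μ := by
          refine lintegral_congr_ae ?_
          filter_upwards [hZ] with ω hω
          refine (Tendsto.liminf_eq (ENNReal.tendsto_ofReal ?_)).symm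
          exact (Real.continuous_exp.tendsto _).comp (hω.const_mul t)
      _ ≤ liminf (fun n => ∫⁻ ω, ENNReal.ofReal (Real.exp (t * perpSum M Q n ω)) ∂μ) atTop :=
          lintegral_liminf_le fun n => by
            have := measurable_perpSum hM hQ n
            fun_prop
      _ ≤ ENNReal.ofReal (h t) := by
          refine (liminf_le_liminf (Eventually.of_forall hn)).trans ?_
          simp
  have hZm : AEMeasurable Z μ :=
    aemeasurable_of_tendsto_metrizable_ae atTop
      (fun n => (measurable_perpSum hM hQ n).aemeasurable) hZ
  refine lt_of_le_of_lt (?_ : _ ≤ (∫⁻ ω, ENNReal.ofReal (Real.exp (s * Z ω)) ∂μ) +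
    ∫⁻ ω, ENNReal.ofReal (Real.exp (-s * Z ω)) ∂μ) (ENNReal.add_lt_top.2
      ⟨(bound s (abs_of_pos hs).le).trans_lt ENNReal.ofReal_lt_top,
        (bound (-s) (by rw [abs_neg, abs_of_pos hs])).trans_lt ENNReal.ofReal_lt_top⟩)
  rw [← lintegral_add_left' (by fun_prop)]
  refine lintegral_mono fun ω => ?_
  rcases abs_cases (Z ω) with h | h
  · simp only [h.1]; exact le_self_add
  · simp only [h.1, mul_neg, neg_mul]; exact le_add_self

/-- The necessary conditions for exponential moments of a perpetuity. -/
theorem IsPerpetuity.necessary_conditions {Z : Ω → ℝ} (hZ : IsPerpetuity μ M Q Z)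
    (hM : ∀ n, Measurable (M n)) (hQ : ∀ n, Measurable (Q n))
    (hindep : iIndepFun (fun n ω => (M n ω, Q n ω)) μ)
    (hident : ∀ n, IdentDistrib (fun ω => (M n ω, Q n ω)) (fun ω => (M 0 ω, Q 0 ω)) μ μ)
    (hM0 : ∀ᵐ ω ∂μ, M 0 ω ≠ 0) (hdegen : ∀ c : ℝ, μ {ω | Q 0 ω + M 0 ω * c = c} < 1)
    (hlt : μ {ω | |M 0 ω| = 1} < 1) {s : ℝ} (hs : 0 < s) (hmom : expAbsMoment μ Z s < ∞) :
    (∀ᵐ ω ∂μ, |M 0 ω| ≤ 1) ∧ expAbsMoment μ (Q 0) s < ∞ ∧ UnitModulusCond μ (M 0) (Q 0) s := by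
  have hfix := hZ.isFixedLaw hM hQ hindep hident hM0
  have hZm : AEMeasurable Z μ :=
    aemeasurable_of_tendsto_metrizable_ae atTop
      (fun n => (measurable_perpSum hM hQ n).aemeasurable) hZ
  have : IsProbabilityMeasure (μ.map Z) := Measure.isProbabilityMeasure_map hZm
  have hmom' : ∫⁻ z, ENNReal.ofReal (Real.exp (s * |z|)) ∂(μ.map Z) < ∞ := by
    rwa [lintegral_map' (by fun_prop) hZm]
  have hm0 := hM 0
  have hq0 := hQ 0
  -- If Z = c almost surely, the fixed point equation forces Q + Mc = c almost surely.
  have hnd : ∀ c : ℝ, (μ.map Z) {z | z ≠ c} ≠ 0 := by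
    intro c hc
    have hms : MeasurableSet {z : ℝ | z ≠ c} := (measurableSet_singleton c).compl
    have hae : ∀ᵐ z ∂(μ.map Z), z = c := by rw [ae_iff]; exact hc
    have h := hfix ({z | z ≠ c}.indicator 1) (measurable_one.indicator hms)
    rw [lintegral_indicator_one hms, hc] at h
    have h2 : ∀ ω, ∫⁻ z, ({z : ℝ | z ≠ c}.indicator 1 (Q 0 ω + M 0 ω * z) : ℝ≥0∞) ∂(μ.map Z) =
        {z : ℝ | z ≠ c}.indicator 1 (Q 0 ω + M 0 ω * c) := by
      intro ω
      rw [lintegral_congr_ae (g := fun _ => {z : ℝ | z ≠ c}.indicator 1 (Q 0 ω + M 0 ω * c))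
        (by filter_upwards [hae] with z hz; rw [hz])]
      simp
    simp_rw [h2] at h
    have hmeas : Measurable fun ω =>
        ({z : ℝ | z ≠ c}.indicator 1 (Q 0 ω + M 0 ω * c) : ℝ≥0∞) :=
      (measurable_one.indicator hms).comp (by fun_prop)
    have h3 := (lintegral_eq_zero_iff hmeas).1 h.symm
    have h4 : ∀ᵐ ω ∂μ, Q 0 ω + M 0 ω * c = c := by
      filter_upwards [h3] with ω hω
      by_contra hne
      rw [Set.indicator_of_mem (show Q 0 ω + M 0 ω * c ∈ {z : ℝ | z ≠ c} from hne)] at hω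
      exact one_ne_zero hω
    exact (hdegen c).ne ((mem_ae_iff_prob_eq_one
      (measurableSet_eq_fun (by fun_prop) measurable_const)).1 h4)
  have hM1 : μ {ω | |M 0 ω| ≠ 1} ≠ 0 := by
    intro h
    have h4 : ∀ᵐ ω ∂μ, |M 0 ω| = 1 := by rw [ae_iff]; exact h
    exact hlt.ne ((mem_ae_iff_prob_eq_one
      (measurableSet_eq_fun (by fun_prop) measurable_const)).1 h4)
  have hle := hfix.ae_abs_le_one hm0 hq0 hnd hs hmom'
  exact ⟨hle, hfix.expAbsMoment_lt_top hle hq0 hs hmom',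
    hfix.unitModulusCond hm0 hq0 hM1 hs hmom'⟩

end Iid

/-! ### The equivalence and the formula for the abscissa -/

theorem theorem4 {Ω : Type*} [MeasurableSpace Ω] (μ : Measure Ω) [IsProbabilityMeasure μ]
    (M Q : ℕ → Ω → ℝ)
    (hM : ∀ n, Measurable (M n)) (hQ : ∀ n, Measurable (Q n))
    (hindep : iIndepFun (fun n ω => (M n ω, Q n ω)) μ)
    (hident : ∀ n, IdentDistrib (fun ω => (M n ω, Q n ω)) (fun ω => (M 0 ω, Q 0 ω)) μ μ)
    (hM0 : μ {ω | M 0 ω = 0} = 0) (hQ0 : μ {ω | Q 0 ω = 0} < 1)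
    (hdegen : ∀ c : ℝ, μ {ω | Q 0 ω + M 0 ω * c = c} < 1)
    (hM1_pos : 0 < μ {ω | |M 0 ω| = 1}) (hM1_lt : μ {ω | |M 0 ω| = 1} < 1) :
    (∀ s : ℝ, 0 < s →
      ((∃ Z : Ω → ℝ, IsPerpetuity μ M Q Z ∧ expAbsMoment μ Z s < ∞) ↔
        ((∀ᵐ ω ∂μ, |M 0 ω| ≤ 1) ∧ expAbsMoment μ (Q 0) s < ∞ ∧
          UnitModulusCond μ (M 0) (Q 0) s))) ∧
    ((∀ᵐ ω ∂μ, |M 0 ω| ≤ 1) →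
      (0 < min (expAbscissa μ (Q 0)) (unitModulusAbscissa μ (M 0) (Q 0)) →
        ∃ Z : Ω → ℝ, IsPerpetuity μ M Q Z) ∧
      ∀ Z : Ω → ℝ, IsPerpetuity μ M Q Z →
        expAbscissa μ Z = min (expAbscissa μ (Q 0)) (unitModulusAbscissa μ (M 0) (Q 0))) := by

  have hM0' : ∀ᵐ ω ∂μ, M 0 ω ≠ 0 := by
    rw [ae_iff]
    simpa using hM0
  have hex : (∀ᵐ ω ∂μ, |M 0 ω| ≤ 1) → ∀ s : ℝ, 0 < s → expAbsMoment μ (Q 0) s < ∞ →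
      ∃ Z : Ω → ℝ, IsPerpetuity μ M Q Z := fun hM1 s hs hmom =>
    exists_isPerpetuity hM hQ hindep hident (lintegral_ofReal_abs_lt_one (hM 0) hM1 hM1_lt)
      (lintegral_abs_lt_top_of_expAbsMoment hs hmom)
  refine ⟨fun s hs => ⟨?_, ?_⟩, fun hM1 => ⟨?_, ?_⟩⟩
  · rintro ⟨Z, hZ, hmom⟩
    exact hZ.necessary_conditions hM hQ hindep hident hM0' hdegen hM1_lt hs hmom
  · rintro ⟨hM1, hmom, hcond⟩
    obtain ⟨Z, hZ⟩ := hex hM1 s hs hmom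
    exact ⟨Z, hZ, hZ.expAbsMoment_lt_top hM hQ hindep hident hM1 hM1_lt hs hmom hcond⟩
  · intro hpos
    obtain ⟨s, hs⟩ := lt_iSup_iff.1 (lt_min_iff.1 hpos).1
    obtain ⟨⟨hs0, hmom⟩, -⟩ := lt_iSup_iff.1 hs
    exact hex hM1 s hs0 hmom
  · intro Z hZ
    refine le_antisymm (iSup₂_le fun r hr => ?_) (le_of_forall_lt fun t ht => ?_)
    · obtain ⟨-, h1, h2⟩ :=
        hZ.necessary_conditions hM hQ hindep hident hM0' hdegen hM1_lt hr.1 hr.2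
      exact le_min (le_iSup₂_of_le r ⟨hr.1, h1⟩ le_rfl) (le_iSup₂_of_le r ⟨hr.1, h2⟩ le_rfl)
    · obtain ⟨r₁, h1⟩ := lt_iSup_iff.1 (lt_min_iff.1 ht).1
      obtain ⟨⟨hr1, hmom⟩, h1⟩ := lt_iSup_iff.1 h1
      obtain ⟨r₂, h2⟩ := lt_iSup_iff.1 (lt_min_iff.1 ht).2
      obtain ⟨⟨hr2, hcond⟩, h2⟩ := lt_iSup_iff.1 h2
      -- The two conditions are known at different exponents; both pass down to the smaller one,
      -- which still exceeds t.
      have hr : 0 < min r₁ r₂ := lt_min hr1 hr2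
      have hfin := hZ.expAbsMoment_lt_top hM hQ hindep hident hM1 hM1_lt hr
        ((expAbsMoment_mono (min_le_left r₁ r₂)).trans_lt hmom)
        (hcond.mono (hM 0) (hQ 0) hM1_lt hr (min_le_right r₁ r₂))
      refine lt_of_lt_of_le ?_ (le_iSup₂_of_le (min r₁ r₂) ⟨hr, hfin⟩ le_rfl)
      rcases min_choice r₁ r₂ with h | h <;> rw [h] <;> assumption
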